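/- Formulas are those of first-order logic with equality, with relation symbols of arity at least $1$ and constant symbols, without function symbols, and with named variables; structures have non-empty domains. The Guarded Fragment (GF) is the least set of formulas that contains all atomic formulas (including $\top$, $\bot$ and equalities), is closed under Boolean connectives, and contains $\exists\bar x\,(\gamma\wedge\psi)$ and $\forall\bar x\,(\gamma\to\psi)$ whenever $\psi$ is in GF, $\gamma$ is a relational atom or an equality, $\bar x$ is a tuple of variables, and both $\mathrm{fv}(\psi)\subseteq\mathrm{fv}(\gamma)$ and $\bar x\subseteq\mathrm{fv}(\gamma)$, where $\mathrm{fv}$ denotes the set of free variables. A signature $\sigma=\mathrm{Rels}\uplus\mathrm{Cons}$ is a finite set of relation symbols and constant symbols; its width is the maximum arity of a relation symbol in it. For $k\in\mathbb N$, a $k$-type over $\sigma$ is a maximal consistent set of non-equality literals over the symbols of $\sigma$ and the variables $x_1,\dots,x_k$ (consistent: containing no atom together with its negation), and $\boldsymbol\tau^{\sigma}_k$ is the set of all $k$-types over $\sigma$. For a sentence $\varphi$, the expanded normal-form signature $\sigma_{\mathrm{nf}}$ of $\varphi$ consists of all relation and constant symbols occurring in $\varphi$, together with one fresh relation symbol $R_\chi$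 for every subformula $\chi$ of $\varphi$ that begins with a maximal block of consecutive quantifiers and has at least one free variable; the arity of $R_\chi$ is the number of free variables of $\chi$. Theorem. There exist sequences $(C_t)_{t\in\mathbb N}$ and $(\varepsilon_t)_{t\in\mathbb N}$ of real numbers with $C_t>0$ and $\varepsilon_t\in(0,1/e)$ for all $t$, and $\varepsilon_t\to 0$ as $t\to\infty$, such that the following holds for every $t\in\mathbb N$. Let $\varphi$ be any satisfiable GF-sentence, let $\sigma_{\mathrm{nf}}$ be its expanded normal-form signature, and let $k$ be the width of $\sigma_{\mathrm{nf}}$. If $k\ge t\ge 2$, then $\varphi$ has a finite model whose domain has size at most \[ C_t\cdot\bigl|\boldsymbol\tau^{\sigma_{\mathrm{nf}}}_{k}\bigr|^{\,1-1/e+\varepsilon_t}. \] -/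

import Mathlib

namespace Guarded

/-! ### First-order formulas with named variables, without function symbols -/

/-- A relation symbol: a name together with a positive arity. -/
structure RelSym where
  name : ℕ
  arity : ℕ
  arity_pos : 0 < arity
deriving DecidableEq

/-- A term is a variable or a constant symbol. -/
inductive Term where
  | var (x : ℕ)
  | const (c : ℕ)
deriving DecidableEq

/-- First-order formulas over countably many variables, constant symbols and relation symbols. -/
inductive Formula where
  | bot
  | top
  | eq (s t : Term)
  | rel (R : RelSym) (ts : Fin R.arity → Term)
  | not (φ : Formula)
  | and (φ ψ : Formula)
  | or (φ ψ : Formula)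
  | imp (φ ψ : Formula)
  | iff (φ ψ : Formula)
  | all (x : ℕ) (φ : Formula)
  | ex (x : ℕ) (φ : Formula)
deriving DecidableEq

/-- The variables of a term. -/
def Term.fv : Term → Finset ℕ
  | .var x => {x}
  | .const _ => ∅

/-- The constant symbols of a term. -/
def Term.consts : Term → Finset ℕ
  | .var _ => ∅
  | .const c => {c}

namespace Formula

/-- The free variables of a formula. -/
def fv : Formula → Finset ℕ
  | bot | top => ∅
  | eq s t => s.fv ∪ t.fv
  | rel _ ts => Finset.univ.biUnion fun i => (ts i).fv
  | not φ => φ.fv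
  | and φ ψ | or φ ψ | imp φ ψ | iff φ ψ => φ.fv ∪ ψ.fv
  | all x φ | ex x φ => φ.fv.erase x

/-- A sentence is a formula without free variables. -/
def IsSentence (φ : Formula) : Prop := φ.fv = ∅

/-- The relation symbols occurring in a formula (equality is a logical symbol). -/
def rels : Formula → Finset RelSym
  | bot | top | eq _ _ => ∅
  | rel R _ => {R}
  | not φ => φ.rels
  | and φ ψ | or φ ψ | imp φ ψ | iff φ ψ => φ.rels ∪ ψ.rels
  | all _ φ | ex _ φ => φ.rels

/-- The constant symbols occurring in a formula. -/
def consts : Formula → Finset ℕ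
  | bot | top => ∅
  | eq s t => s.consts ∪ t.consts
  | rel _ ts => Finset.univ.biUnion fun i => (ts i).consts
  | not φ => φ.consts
  | and φ ψ | or φ ψ | imp φ ψ | iff φ ψ => φ.consts ∪ ψ.consts
  | all _ φ | ex _ φ => φ.consts

/-- Atomic formulas that may serve as guards: equalities and relational atoms. -/
inductive IsAtom : Formula → Prop
  | eq (s t : Term) : IsAtom (eq s t)
  | rel (R : RelSym) (ts : Fin R.arity → Term) : IsAtom (rel R ts)

/-- `∃ x₁ … xₘ, φ`. -/
def exs (xs : List ℕ) (φ : Formula) : Formula := xs.foldr ex φ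

/-- `∀ x₁ … xₘ, φ`. -/
def alls (xs : List ℕ) (φ : Formula) : Formula := xs.foldr all φ

/-- The Guarded Fragment. -/
inductive IsGF : Formula → Prop
  | bot : IsGF bot
  | top : IsGF top
  | atom {γ : Formula} : IsAtom γ → IsGF γ
  | not {φ : Formula} : IsGF φ → IsGF (not φ)
  | and {φ ψ : Formula} : IsGF φ → IsGF ψ → IsGF (and φ ψ)
  | or {φ ψ : Formula} : IsGF φ → IsGF ψ → IsGF (or φ ψ)
  | imp {φ ψ : Formula} : IsGF φ → IsGF ψ → IsGF (imp φ ψ)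
  | iff {φ ψ : Formula} : IsGF φ → IsGF ψ → IsGF (iff φ ψ)
  | exs (xs : List ℕ) {γ ψ : Formula} : IsAtom γ → IsGF ψ →
      ψ.fv ⊆ γ.fv → xs.toFinset ⊆ γ.fv → IsGF (exs xs (and γ ψ))
  | alls (xs : List ℕ) {γ ψ : Formula} : IsAtom γ → IsGF ψ →
      ψ.fv ⊆ γ.fv → xs.toFinset ⊆ γ.fv → IsGF (alls xs (imp γ ψ))

/-- Auxiliary to `blockSubformulas`; the flag says whether the formula is the immediate
subformula of a quantified formula, so that a leading quantifier would continue a block. -/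
def blockSubformulasAux : Bool → Formula → Finset Formula
  | _, bot | _, top | _, eq _ _ | _, rel _ _ => ∅
  | _, not φ => blockSubformulasAux false φ
  | _, and φ ψ | _, or φ ψ | _, imp φ ψ | _, iff φ ψ =>
      blockSubformulasAux false φ ∪ blockSubformulasAux false ψ
  | b, all x φ => (if b then ∅ else {all x φ}) ∪ blockSubformulasAux true φ
  | b, ex x φ => (if b then ∅ else {ex x φ}) ∪ blockSubformulasAux true φ

/-- The subformulas of `φ` that begin with a maximal block of quantifiers. -/
def blockSubformulas (φ : Formula) : Finset Formula := blockSubformulasAux false φ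

end Formula

/-! ### Semantics -/

/-- A structure with domain `A`. It interprets every symbol; the interpretation of symbols that do
not occur in a formula is irrelevant to its truth. The domain is non-empty, since it contains the
interpretations of the constant symbols. -/
structure Struc (A : Type) where
  relI : (R : RelSym) → (Fin R.arity → A) → Prop
  constI : ℕ → A

namespace Struc

variable {A : Type} (M : Struc A)

/-- The value of a term under an assignment. -/
def val (v : ℕ → A) : Term → A
  | .var x => v x
  | .const c => M.constI c

/-- Truth of a formula under an assignment. -/
def Sat : (ℕ → A) → Formula → Prop
  | _, .bot => False
  | _, .top => True
  | v, .eq s t => M.val v s = M.val v t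
  | v, .rel R ts => M.relI R fun i => M.val v (ts i)
  | v, .not φ => ¬ Sat v φ
  | v, .and φ ψ => Sat v φ ∧ Sat v ψ
  | v, .or φ ψ => Sat v φ ∨ Sat v ψ
  | v, .imp φ ψ => Sat v φ → Sat v ψ
  | v, .iff φ ψ => (Sat v φ ↔ Sat v ψ)
  | v, .all x φ => ∀ a : A, Sat (Function.update v x a) φ
  | v, .ex x φ => ∃ a : A, Sat (Function.update v x a) φ

/-- `M` is a model of the sentence `φ`. -/
def Models (φ : Formula) : Prop := ∀ v : ℕ → A, M.Sat v φ

end Struc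

/-- `φ` has a model, of any cardinality. -/
def Satisfiable (φ : Formula) : Prop := ∃ (A : Type) (M : Struc A), M.Models φ

/-! ### Signatures and types -/

/-- A finite signature: relation symbols of positive arity, and constant symbols. -/
structure Signature where
  Rels : Type
  Cons : Type
  [fintypeRels : Fintype Rels]
  [fintypeCons : Fintype Cons]
  ar : Rels → ℕ
  ar_pos : ∀ R, 0 < ar R

namespace Signature

attribute [instance] Signature.fintypeRels Signature.fintypeCons

variable (σ : Signature)

/-- The maximum arity of a relation symbol. -/
def width : ℕ := Finset.univ.sup σ.ar

/-- A relational (non-equality) atom over the variables `x₁, …, xₖ` and the constants of `σ`. -/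
structure Atom (k : ℕ) where
  R : σ.Rels
  args : Fin (σ.ar R) → Fin k ⊕ σ.Cons

/-- The non-equality literals over the variables `x₁, …, xₖ`. -/
inductive Lit (k : ℕ) where
  | pos (α : σ.Atom k)
  | neg (α : σ.Atom k)

variable {σ}

/-- A set of non-equality literals (with distinct constants denoting distinct elements) is
consistent if and only if it contains no complementary pair. -/
def Consistent {k : ℕ} (T : Set (σ.Lit k)) : Prop :=
  ∀ α : σ.Atom k, ¬ (Lit.pos α ∈ T ∧ Lit.neg α ∈ T)

variable (σ)

/-- The set of all `k`-types over `σ`: the maximal consistent sets of literals. -/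
def types (k : ℕ) : Set (Set (σ.Lit k)) := {T | Maximal Consistent T}

end Signature

/-- The expanded normal-form signature of `φ`: the symbols of `φ`, together with a fresh relation
symbol `R_χ` for every subformula `χ` of `φ` that begins with a maximal block of quantifiers and has
free variables; the arity of `R_χ` is the number of free variables of `χ`. -/
def nfSignature (φ : Formula) : Signature where
  Rels := {R // R ∈ φ.rels} ⊕ {χ // χ ∈ φ.blockSubformulas.filter fun χ : Formula => ¬ χ.fv = ∅}
  Cons := {c // c ∈ φ.consts}
  ar := Sum.elim (fun R => R.1.arity) (fun χ => χ.1.fv.card)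
  ar_pos := by
    rintro (R | χ)
    · exact R.1.arity_pos
    · exact Finset.card_pos.2 (Finset.nonempty_iff_ne_empty.2 (Finset.mem_filter.1 χ.2).2)

end Guarded

/-! Let k = m + 1 be the width, N the number of atoms over k variables and the constants, and d the
number of atoms that mention the last variable, with constants of equal value identified. There are
at least 2^N types, so a model with about 2^d elements is wanted. A tuple of length r ≤ k avoids a
given variable in a share at least (1 - 1/k)^k of all cases, and this ratio increases to 1/e; hence
d ≤ (1 - (1 - 1/k)^k) N.

Take a random structure ω on about 2^d N² points. Given m points and a pattern of d atoms, each
further point realizes the pattern with probability 2^(-d), independently, so by a union bound some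
ω realizes all one-point extensions (`exists_hasExtensions`, `extension_estimate`).

This ω knows nothing of the given model M and serves only as advice. By recursion on sets S of
points, S is labelled with a map into M whose type agrees with the labels of the proper subsets,
following ω wherever possible; the finite structure is read off from the labels. Since ω offers
every pattern, a local isomorphism on at most m points extends to any further element of M
(`LocalIso.extend`).

Truth of guarded formulas then transfers by a back-and-forth argument. A witness in the finite
structure lies under some local isomorphism, perhaps not the given one; the two agree on a
quantified subformula χ because the types record its truth through R_χ (`sat_block_iff_of_locIso`).
The resulting size is at most 18 N² 2^d, and N² is absorbed by 2^(δN) for a small δ. -/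

namespace Guarded

/-! ### Random structures with the extension property -/

/-- The number of two-colourings of `α` that avoid the pattern `q` on each of the disjoint copies of
`D` given by `e`. -/
theorem card_avoiding_mul_le {α Y D : Type*} [Fintype α] [Fintype Y] [Fintype D]
    (e : Y × D → α) (he : Function.Injective e) (q : D → Bool) :
    Nat.card {ω : α → Bool // ∀ y, (fun δ => ω (e (y, δ))) ≠ q} *
        2 ^ (Fintype.card Y * Fintype.card D) ≤
      2 ^ Fintype.card α * (2 ^ Fintype.card D - 1) ^ Fintype.card Y := by
  classical
  have hα : Fintype.card α =
      Fintype.card Y * Fintype.card D + Fintype.card {a // a ∉ Set.range e} := by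
    rw [← Fintype.card_prod, ← Set.card_range_of_injective he]
    have h1 := Fintype.card_subtype_compl (fun a => a ∈ Set.range e)
    have h2 := Fintype.card_subtype_le (fun a => a ∈ Set.range e)
    have h3 : Fintype.card {a // a ∈ Set.range e} = Fintype.card (Set.range e) := rfl
    omega
  let f : {ω : α → Bool // ∀ y, (fun δ => ω (e (y, δ))) ≠ q} →
      ({a // a ∉ Set.range e} → Bool) × (Y → {p : D → Bool // p ≠ q}) :=
    fun ω => (fun a => ω.1 a.1, fun y => ⟨fun δ => ω.1 (e (y, δ)), ω.2 y⟩)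
  have hf : Function.Injective f := by
    rintro ⟨ω, hω⟩ ⟨ω', hω'⟩ h
    apply Subtype.ext
    funext a
    by_cases ha : a ∈ Set.range e
    · obtain ⟨⟨y, δ⟩, rfl⟩ := ha
      have h2 := congrFun (congrArg Prod.snd h) y
      exact congrFun (congrArg Subtype.val h2) δ
    · exact congrFun (congrArg Prod.fst h) ⟨a, ha⟩
  have hcard := Nat.card_le_card_of_injective f hf
  have hq : Fintype.card {p : D → Bool // p ≠ q} = 2 ^ Fintype.card D - 1 := by
    simp
  have hcod : Nat.card (({a // a ∉ Set.range e} → Bool) × (Y → {p : D → Bool // p ≠ q})) =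
      2 ^ Fintype.card {a // a ∉ Set.range e} *
        (2 ^ Fintype.card D - 1) ^ Fintype.card Y := by
    rw [Nat.card_eq_fintype_card, Fintype.card_prod, Fintype.card_fun, Fintype.card_fun, hq,
      Fintype.card_bool]
  rw [hcod] at hcard
  calc _ ≤ _ := Nat.mul_le_mul_right _ hcard
    _ = _ := by rw [hα, pow_add]; ring

/-- Atoms over `m + 1` variables and the constants `K` that mention the last variable `none`. -/
abbrev PointedAtom {Rl : Type} (ar : Rl → ℕ) (K : Type) (m : ℕ) : Type :=
  Σ R : Rl, {args : Fin (ar R) → Option (Fin m) ⊕ K // ∃ i, args i = Sum.inl none}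

/-- Complementary count: all argument tuples minus those that avoid `none`. -/
theorem card_pointedAtom {Rl K : Type} [Fintype Rl] [Fintype K] (ar : Rl → ℕ) (m : ℕ) :
    Nat.card (PointedAtom ar K m) =
      ∑ R, ((m + 1 + Fintype.card K) ^ ar R - (m + Fintype.card K) ^ ar R) := by
  classical
  rw [Nat.card_eq_fintype_card, Fintype.card_sigma]
  refine Finset.sum_congr rfl fun R _ => ?_
  have h1 := Fintype.card_subtype_compl
    (fun args : Fin (ar R) → Option (Fin m) ⊕ K => ∀ i, args i ≠ Sum.inl none)
  have h2 : Fintype.card {args : Fin (ar R) → Option (Fin m) ⊕ K // ∀ i, args i ≠ Sum.inl none} =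
      (m + Fintype.card K) ^ ar R := by
    rw [Fintype.card_congr (Equiv.subtypePiEquivPi
      (p := fun _ (s : Option (Fin m) ⊕ K) => s ≠ Sum.inl none)), Fintype.card_pi]
    simp
  rw [h2] at h1
  simp only [not_forall, not_not] at h1
  rw [h1]
  simp

/-- The structure `ω` on `Fin n ⊕ K` realizes every one-point extension of every `m` elements. -/
def HasExtensions {Rl K : Type} (ar : Rl → ℕ) (m n : ℕ)
    (ω : ∀ R, (Fin (ar R) → Fin n ⊕ K) → Prop) : Prop :=
  ∀ (x : Fin m ↪ Fin n) (q : ∀ R, (Fin (ar R) → Option (Fin m) ⊕ K) → Prop),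
    ∃ y, y ∉ Set.range x ∧ ∀ R (args : Fin (ar R) → Option (Fin m) ⊕ K),
      (∃ i, args i = Sum.inl none) →
        (ω R (fun i => Sum.map (fun o => o.elim y x) id (args i)) ↔ q R args)

/-- Union bound over at most `n ^ m * 2 ^ d` pairs of an embedding and a pattern. Different `y` use
disjoint sets of atoms, so a pair fails for a share at most (1 - 2^(-d))^(n - m) of all structures;
`hlt` says that the shares sum to less than 1. -/
theorem exists_hasExtensions {Rl K : Type} [Finite Rl] [Finite K] (ar : Rl → ℕ) (m n d : ℕ)
    (hd : Nat.card (PointedAtom ar K m) = d)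
    (hlt : n ^ m * 2 ^ d * (2 ^ d - 1) ^ (n - m) < 2 ^ ((n - m) * d)) :
    ∃ ω : ∀ R, (Fin (ar R) → Fin n ⊕ K) → Prop, HasExtensions ar m n ω := by
  classical
  cases nonempty_fintype Rl
  cases nonempty_fintype K
  rw [Nat.card_eq_fintype_card] at hd
  let α := Σ R : Rl, (Fin (ar R) → Fin n ⊕ K)
  let D := PointedAtom ar K m
  let e : (x : Fin m ↪ Fin n) → {y // y ∉ Set.range x} × D → α := fun x p =>
    ⟨p.2.1, fun i => Sum.map (fun o => o.elim p.1.1 x) id (p.2.2.1 i)⟩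
  have he : ∀ x, Function.Injective (e x) := by
    intro x ⟨⟨y, hy⟩, ⟨R, a, ha⟩⟩ ⟨⟨y', hy'⟩, ⟨R', a', ha'⟩⟩ h
    obtain rfl : R = R' := congrArg Sigma.fst h
    have h2 : ∀ i, Sum.map (fun o => Option.elim o y x) id (a i) =
        Sum.map (fun o => Option.elim o y' x) id (a' i) := by
      have := eq_of_heq (Sigma.mk.inj h).2
      exact fun i => congrFun this i
    -- An argument equal to `none` reveals `y`, since `y` is outside the range of `x`.
    have hyy : y = y' := by
      obtain ⟨i, hi⟩ := ha
      have := h2 i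
      rw [hi] at this
      rcases hj : a' i with (_ | j) | c
      · simpa [hj] using this
      · simp [hj] at this
        exact absurd ⟨j, this.symm⟩ hy
      · simp [hj] at this
    subst hyy
    have hinj : Function.Injective (Sum.map (fun o => Option.elim o y x) (id : K → K)) := by
      refine Function.Injective.sumMap ?_ Function.injective_id
      rintro (_ | i) (_ | j) hij
      · rfl
      · exact absurd ⟨j, hij.symm⟩ hy
      · exact absurd ⟨i, hij⟩ hy
      · exact congrArg some (x.injective hij)
    obtain rfl : a = a' := funext fun i => hinj (h2 i)
    rfl
  by_contra! hno
  let bad : (Fin m ↪ Fin n) × (D → Bool) → Finset (α → Bool) := fun p =>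
    Finset.univ.filter fun ω => ∀ y, (fun δ => ω (e p.1 (y, δ))) ≠ p.2
  have hcover : (Finset.univ : Finset (α → Bool)) ⊆ Finset.univ.biUnion bad := by
    intro ω _
    have h := hno fun R args => ω ⟨R, args⟩ = true
    simp only [HasExtensions, not_forall] at h
    obtain ⟨x, q, h⟩ := h
    push Not at h
    refine Finset.mem_biUnion.2 ⟨(x, fun δ => decide (q δ.1 δ.2.1)), Finset.mem_univ _, ?_⟩
    refine Finset.mem_filter.2 ⟨Finset.mem_univ _, fun y hy => ?_⟩
    obtain ⟨R, args, hargs, hne⟩ := h y.1 y.2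
    have h3 := congrFun hy ⟨R, args, hargs⟩
    have h4 : ω (e x (y, ⟨R, args, hargs⟩)) = true ↔ q R args := by
      rw [h3]; simp
    rcases hne with hne | hne
    · exact hne.2 (h4.1 hne.1)
    · exact hne.1 (h4.2 hne.2)
  have hbad : ∀ p, (bad p).card * 2 ^ ((n - m) * d) ≤
      2 ^ Fintype.card α * (2 ^ d - 1) ^ (n - m) := by
    intro p
    have h := card_avoiding_mul_le (e p.1) (he p.1) p.2
    have hY : Fintype.card {y // y ∉ Set.range p.1} = n - m := by
      have h := Set.card_range_of_injective p.1.injective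
      rw [Fintype.card_subtype_compl, Fintype.card_fin]
      rw [Fintype.card_fin] at h
      exact congrArg (n - ·) h
    have hD : Fintype.card D = d := hd
    rw [hY, hD, Nat.card_eq_fintype_card, Fintype.card_subtype] at h
    exact h
  have hx : Fintype.card (Fin m ↪ Fin n) ≤ n ^ m := by
    simpa using Fintype.card_le_of_injective (fun f : Fin m ↪ Fin n => (f : Fin m → Fin n))
      DFunLike.coe_injective
  have hD2 : Fintype.card (D → Bool) = 2 ^ d := by
    rw [Fintype.card_fun, Fintype.card_bool]; congr 1
  have hsum : 2 ^ Fintype.card α * 2 ^ ((n - m) * d) ≤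
      n ^ m * 2 ^ d * (2 ^ Fintype.card α * (2 ^ d - 1) ^ (n - m)) := by
    calc 2 ^ Fintype.card α * 2 ^ ((n - m) * d)
        = (Finset.univ : Finset (α → Bool)).card * 2 ^ ((n - m) * d) := by
          rw [Finset.card_univ, Fintype.card_fun, Fintype.card_bool]
      _ ≤ (∑ p, (bad p).card) * 2 ^ ((n - m) * d) :=
          Nat.mul_le_mul_right _ ((Finset.card_le_card hcover).trans Finset.card_biUnion_le)
      _ = ∑ p, (bad p).card * 2 ^ ((n - m) * d) := Finset.sum_mul _ _ _
      _ ≤ ∑ _p : (Fin m ↪ Fin n) × (D → Bool), 2 ^ Fintype.card α * (2 ^ d - 1) ^ (n - m) :=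
          Finset.sum_le_sum fun p _ => hbad p
      _ = Fintype.card (Fin m ↪ Fin n) * 2 ^ d *
            (2 ^ Fintype.card α * (2 ^ d - 1) ^ (n - m)) := by
          rw [Finset.sum_const, Finset.card_univ, Fintype.card_prod, hD2, smul_eq_mul]
      _ ≤ _ := by gcongr
  have hpos : 0 < 2 ^ Fintype.card α := by positivity
  have := Nat.mul_lt_mul_of_pos_left hlt hpos
  have h5 : n ^ m * 2 ^ d * (2 ^ Fintype.card α * (2 ^ d - 1) ^ (n - m)) =
    2 ^ Fintype.card α * (n ^ m * 2 ^ d * (2 ^ d - 1) ^ (n - m)) := by ring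
  omega

/-! ### Finite structures that are locally isomorphic to a given structure -/

/-- Choice along strict inclusion. The recursion sees only values below `S`, padded by `default`;
`hcongr` passes from this truncated function to the full one. -/
theorem exists_forall_of_ssubset_rec {β X : Type*} [DecidableEq β] [Inhabited X]
    (P : Finset β → (Finset β → X) → X → Prop)
    (hcongr : ∀ S H H' v, (∀ T, T ⊂ S → H T = H' T) → P S H v → P S H' v)
    (hex : ∀ S H, ∃ v, P S H v) : ∃ h : Finset β → X, ∀ S, P S h (h S) := by
  choose F hF using hex
  let h : Finset β → X := Finset.strongInduction (p := fun _ => X)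
    fun S ih => F S fun T => if hT : T ⊂ S then ih T hT else default
  refine ⟨h, fun S => ?_⟩
  have hS : h S = F S fun T => if T ⊂ S then h T else default := by
    simp only [h]
    rw [Finset.strongInduction_eq]
    simp
  rw [hS]
  exact hcongr S _ _ _ (fun T hT => by simp [hT]) (hF S _)

section Labelling

variable {Rl K A : Type} {ar : Rl → ℕ} {n : ℕ}

open Classical in
/-- The elements of `Fin n` among the arguments. -/
noncomputable def support {r : ℕ} (args : Fin r → Fin n ⊕ K) : Finset (Fin n) :=
  Finset.univ.filter fun j => ∃ i, args i = Sum.inl j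

theorem mem_support {r : ℕ} {args : Fin r → Fin n ⊕ K} {j : Fin n} :
    j ∈ support args ↔ ∃ i, args i = Sum.inl j := by simp [support]

variable (I : ∀ R, (Fin (ar R) → A) → Prop) (ι : K → A)

/-- Two maps give the same type to the elements of `S`. -/
def TypeEq (S : Finset (Fin n)) (g f : Fin n → A) : Prop :=
  ∀ R (args : Fin (ar R) → Fin n ⊕ K), support args ⊆ S →
    (I R (fun i => Sum.elim g ι (args i)) ↔ I R (fun i => Sum.elim f ι (args i)))

/-- `g` is injective on `S` and avoids the constants there. -/
def Proper (S : Finset (Fin n)) (g : Fin n → A) : Prop :=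
  Set.InjOn g S ∧ ∀ j ∈ S, g j ∉ Set.range ι

/-- `g` is compatible with the labels `h` of the proper subsets of `S`. -/
def Compatible (h : Finset (Fin n) → Option (Fin n → A)) (S : Finset (Fin n)) (g : Fin n → A) :
    Prop :=
  Proper ι S g ∧ ∀ T, T ⊂ S → ∃ gT, h T = some gT ∧ TypeEq I ι T g gT

/-- `g` agrees with `ω` on the atoms with support exactly `S`. -/
def Fits (ω : ∀ R, (Fin (ar R) → Fin n ⊕ K) → Prop) (S : Finset (Fin n)) (g : Fin n → A) : Prop :=
  ∀ R (args : Fin (ar R) → Fin n ⊕ K), support args = S →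
    (ω R args ↔ I R (fun i => Sum.elim g ι (args i)))

/-- A choice of compatible labels, following `ω` wherever possible. -/
def IsLabelling (ω : ∀ R, (Fin (ar R) → Fin n ⊕ K) → Prop)
    (h : Finset (Fin n) → Option (Fin n → A)) : Prop :=
  ∀ S, (∀ g, h S = some g → Compatible I ι h S g) ∧
    ((∃ g, Compatible I ι h S g) → ∃ g, h S = some g) ∧
    ((∃ g, Compatible I ι h S g ∧ Fits I ι ω S g) → ∃ g, h S = some g ∧ Fits I ι ω S g)

/-- Compatibility at `S` looks only at proper subsets, so recursion applies: prefer a compatible map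
that fits `ω`, then any compatible map, then `none`. -/
theorem exists_isLabelling (ω : ∀ R, (Fin (ar R) → Fin n ⊕ K) → Prop) :
    ∃ h : Finset (Fin n) → Option (Fin n → A), IsLabelling I ι ω h := by
  have hc : ∀ (S : Finset (Fin n)) (H H' : Finset (Fin n) → Option (Fin n → A)) (g : Fin n → A),
      (∀ T, T ⊂ S → H T = H' T) → (Compatible I ι H S g ↔ Compatible I ι H' S g) := by
    intro S H H' g hT
    refine and_congr Iff.rfl (forall₂_congr fun T h => ?_)
    rw [hT T h]
  refine exists_forall_of_ssubset_rec
    (fun S H v => (∀ g, v = some g → Compatible I ι H S g) ∧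
      ((∃ g, Compatible I ι H S g) → ∃ g, v = some g) ∧
      ((∃ g, Compatible I ι H S g ∧ Fits I ι ω S g) → ∃ g, v = some g ∧ Fits I ι ω S g)) ?_ ?_
  · intro S H H' v hT hP
    simpa only [hc S H H' _ hT] using hP
  · intro S H
    by_cases h1 : ∃ g, Compatible I ι H S g ∧ Fits I ι ω S g
    · obtain ⟨g, hg, hf⟩ := h1
      exact ⟨some g, by rintro _ ⟨⟩; exact hg, fun _ => ⟨g, rfl⟩, fun _ => ⟨g, rfl, hf⟩⟩
    by_cases h2 : ∃ g, Compatible I ι H S g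
    · obtain ⟨g, hg⟩ := h2
      exact ⟨some g, by rintro _ ⟨⟩; exact hg, fun _ => ⟨g, rfl⟩, fun h => absurd h h1⟩
    · exact ⟨none, by simp, fun h => absurd h h2, fun h => absurd h h1⟩

/-- The structure on `Fin n ⊕ K` read off from a labelling. -/
def labelRel (h : Finset (Fin n) → Option (Fin n → A)) (R : Rl) (args : Fin (ar R) → Fin n ⊕ K) :
    Prop :=
  ∃ g, h (support args) = some g ∧ I R (fun i => Sum.elim g ι (args i))

/-- `g` is a local isomorphism on `S ∪ K`. -/
def LocalIso (h : Finset (Fin n) → Option (Fin n → A)) (S : Finset (Fin n)) (g : Fin n → A) :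
    Prop :=
  Proper ι S g ∧ ∃ g', h S = some g' ∧ TypeEq I ι S g g'

variable {I ι} {ω : ∀ R, (Fin (ar R) → Fin n ⊕ K) → Prop}
  {h : Finset (Fin n) → Option (Fin n → A)}

theorem TypeEq.mono {S T : Finset (Fin n)} {g g' : Fin n → A} (hg : TypeEq I ι S g g')
    (hT : T ⊆ S) : TypeEq I ι T g g' := fun R args ha => hg R args (ha.trans hT)

theorem TypeEq.trans {S : Finset (Fin n)} {g g' g'' : Fin n → A} (h1 : TypeEq I ι S g g')
    (h2 : TypeEq I ι S g' g'') : TypeEq I ι S g g'' :=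
  fun R args ha => (h1 R args ha).trans (h2 R args ha)

theorem TypeEq.symm {S : Finset (Fin n)} {g g' : Fin n → A} (h1 : TypeEq I ι S g g') :
    TypeEq I ι S g' g := fun R args ha => (h1 R args ha).symm

theorem TypeEq.refl (S : Finset (Fin n)) (g : Fin n → A) : TypeEq I ι S g g :=
  fun _ _ _ => Iff.rfl

theorem typeEq_of_eqOn {S : Finset (Fin n)} {g g' : Fin n → A} (hg : ∀ j ∈ S, g j = g' j) :
    TypeEq I ι S g g' := by
  intro R args ha
  have : (fun i => Sum.elim g ι (args i)) = fun i => Sum.elim g' ι (args i) := by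
    funext i
    rcases hi : args i with j | c
    · exact hg j (ha (mem_support.2 ⟨i, hi⟩))
    · rfl
  rw [this]

theorem Proper.mono {S T : Finset (Fin n)} {g : Fin n → A} (hg : Proper ι S g) (hT : T ⊆ S) :
    Proper ι T g :=
  ⟨hg.1.mono (by exact_mod_cast hT), fun j hj => hg.2 j (hT hj)⟩

/-- Atoms of smaller support are already settled by the common label of that support, so only those
with support exactly `S` need comparing. -/
theorem Compatible.typeEq {S : Finset (Fin n)} {g g' : Fin n → A}
    (hg : Compatible I ι h S g) (hg' : Compatible I ι h S g')
    (hS : ∀ R (args : Fin (ar R) → Fin n ⊕ K), support args = S →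
      (I R (fun i => Sum.elim g ι (args i)) ↔ I R (fun i => Sum.elim g' ι (args i)))) :
    TypeEq I ι S g g' := by
  intro R args ha
  rcases eq_or_ssubset_of_subset ha with he | hs
  · exact hS R args he
  · obtain ⟨g1, h1, t1⟩ := hg.2 _ hs
    obtain ⟨g2, h2, t2⟩ := hg'.2 _ hs
    obtain rfl : g1 = g2 := Option.some.inj (h1.symm.trans h2)
    exact (t1.trans t2.symm) R args subset_rfl

theorem LocalIso.mono (hh : IsLabelling I ι ω h) {S T : Finset (Fin n)} {g : Fin n → A}
    (hg : LocalIso I ι h S g) (hT : T ⊆ S) : LocalIso I ι h T g := by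
  rcases eq_or_ssubset_of_subset hT with rfl | hs
  · exact hg
  · obtain ⟨hp, g', h1, t1⟩ := hg
    obtain ⟨g2, h2, t2⟩ := ((hh S).1 g' h1).2 T hs
    exact ⟨hp.mono hT, g2, h2, (t1.mono hT).trans t2⟩

theorem LocalIso.labelRel_iff (hh : IsLabelling I ι ω h) {S : Finset (Fin n)} {g : Fin n → A}
    (hg : LocalIso I ι h S g) (R : Rl) (args : Fin (ar R) → Fin n ⊕ K) (ha : support args ⊆ S) :
    labelRel I ι h R args ↔ I R (fun i => Sum.elim g ι (args i)) := by
  obtain ⟨-, g', h1, t1⟩ := hg.mono hh ha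
  rw [t1 R args subset_rfl]
  constructor
  · rintro ⟨g2, h2, hI⟩
    obtain rfl : g2 = g' := Option.some.inj (h2.symm.trans h1)
    exact hI
  · exact fun hI => ⟨g', h1, hI⟩

theorem localIso_of_labelRel (hh : IsLabelling I ι ω h) {R : Rl} {args : Fin (ar R) → Fin n ⊕ K}
    (ha : labelRel I ι h R args) : ∃ g, LocalIso I ι h (support args) g := by
  obtain ⟨g, h1, -⟩ := ha
  exact ⟨g, ((hh _).1 g h1).1, g, h1, TypeEq.refl _ _⟩

/-- The chosen label may differ from `g`, but both follow `ω` on the atoms of full support, which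
fixes the type. -/
theorem Compatible.exists_label (hh : IsLabelling I ι ω h) {S : Finset (Fin n)} {g : Fin n → A}
    (hg : Compatible I ι h S g) (hf : Fits I ι ω S g) :
    ∃ g', h S = some g' ∧ TypeEq I ι S g g' := by
  obtain ⟨g', h1, hf'⟩ := (hh S).2.2 ⟨g, hg, hf⟩
  exact ⟨g', h1, hg.typeEq ((hh S).1 g' h1) fun R args ha =>
    (hf R args ha).symm.trans (hf' R args ha)⟩

theorem localIso_empty (hh : IsLabelling I ι ω h) (g : Fin n → A) : LocalIso I ι h ∅ g := by
  have hc : ∀ g, Compatible I ι h ∅ g := fun g =>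
    ⟨⟨by simp, by simp⟩, fun T hT => absurd hT (Finset.not_ssubset_empty T)⟩
  obtain ⟨g', h1⟩ := (hh ∅).2.1 ⟨g, hc g⟩
  exact ⟨(hc g).1, g', h1, typeEq_of_eqOn (by simp)⟩

theorem exists_localIso_singleton (hh : IsLabelling I ι ω h) {a : A} (ha : a ∉ Set.range ι)
    (j : Fin n) : ∃ g, LocalIso I ι h {j} g := by
  have hc : Compatible I ι h {j} fun _ => a := by
    refine ⟨⟨by simp, fun _ _ => ha⟩, fun T hT => ?_⟩
    obtain rfl := Finset.ssubset_singleton_iff.1 hT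
    exact (localIso_empty hh fun _ => a).2
  obtain ⟨g, hg⟩ := (hh {j}).2.1 ⟨_, hc⟩
  exact ⟨g, ((hh _).1 g hg).1, g, hg, TypeEq.refl _ _⟩

/-- The extension property, applied to the pattern of `a` over `g`, yields a point `y` at which the
extended map fits `ω` on every `insert y T` with `T ⊆ S`. Induction on `T` shows that the label of
`insert y T` has the type of the extended map. -/
theorem LocalIso.extend (hh : IsLabelling I ι ω h) {m : ℕ} (hω : HasExtensions ar m n ω)
    (hmn : m ≤ n) {S : Finset (Fin n)} {g : Fin n → A} (hg : LocalIso I ι h S g)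
    (hS : S.card ≤ m) {a : A} (ha : a ∉ Set.range ι) (hag : ∀ j ∈ S, g j ≠ a) :
    ∃ y, y ∉ S ∧ LocalIso I ι h (insert y S) (Function.update g y a) := by
  classical
  -- The extension property speaks of exactly `m` points; the values of `g` on the added ones play
  -- no role.
  obtain ⟨S', hSS', -, hS'⟩ := Finset.exists_subsuperset_card_eq (Finset.subset_univ S) hS
    (by simpa using hmn)
  let x : Fin m ↪ Fin n := (S'.orderEmbOfFin hS').toEmbedding
  have hx : Set.range x = S' := S'.range_orderEmbOfFin hS'
  obtain ⟨y, hy, hyω⟩ := hω x fun R args =>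
    I R fun i => Sum.elim (fun o : Option (Fin m) => o.elim a fun j => g (x j)) ι (args i)
  rw [hx] at hy
  have hyS : y ∉ S := fun hys => hy (hSS' hys)
  set g' := Function.update g y a with hg'
  have hfit : ∀ T ⊆ S, Fits I ι ω (insert y T) g' := by
    intro T hT R args hargs
    have hpre : ∀ i, ∃ s : Option (Fin m) ⊕ K,
        Sum.map (fun o => o.elim y x) id s = args i ∧ (args i = Sum.inl y → s = Sum.inl none) := by
      intro i
      rcases hi : args i with j | c
      · have hj : j ∈ insert y T := hargs ▸ mem_support.2 ⟨i, hi⟩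
        by_cases hjy : j = y
        · exact ⟨Sum.inl none, by simp [hjy], fun _ => rfl⟩
        · have hjS : j ∈ Set.range x := by
            rw [hx]
            exact hSS' (hT ((Finset.mem_insert.1 hj).resolve_left hjy))
          obtain ⟨l, hl⟩ := hjS
          exact ⟨Sum.inl (some l), by simp [hl], fun h => absurd (Sum.inl.inj h) hjy⟩
      · exact ⟨Sum.inr c, rfl, by simp⟩
    choose s hs hs' using hpre
    obtain ⟨i0, hi0⟩ := mem_support.1 (hargs ▸ Finset.mem_insert_self y T : y ∈ support args)
    have key := hyω R s ⟨i0, hs' i0 hi0⟩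
    have e1 : (fun i => Sum.map (fun o : Option (Fin m) => o.elim y x) id (s i)) = args :=
      funext hs
    have e2 : (fun i => Sum.elim (fun o : Option (Fin m) => o.elim a fun j => g (x j)) ι (s i)) =
        fun i => Sum.elim g' ι (args i) := by
      funext i
      rw [← hs i]
      rcases s i with (_ | l) | c
      · simp [hg']
      · have : x l ≠ y := fun h => hy (hx ▸ ⟨l, h⟩)
        simp [hg', Function.update_of_ne this]
      · rfl
    rw [e1, e2] at key
    exact key
  have heq : ∀ j ∈ S, g' j = g j := fun j hj =>
    Function.update_of_ne (fun h : j = y => hyS (h ▸ hj)) _ _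
  have hprop : Proper ι (insert y S) g' := by
    constructor
    · intro i hi j hj hij
      simp only [Finset.coe_insert, Set.mem_insert_iff, Finset.mem_coe] at hi hj
      rcases hi with rfl | hi <;> rcases hj with rfl | hj
      · rfl
      · rw [heq j hj] at hij
        simp only [hg', Function.update_self] at hij
        exact absurd hij.symm (hag j hj)
      · rw [heq i hi] at hij
        simp only [hg', Function.update_self] at hij
        exact absurd hij (hag i hi)
      · rw [heq i hi, heq j hj] at hij
        exact hg.1.1 hi hj hij
    · intro j hj
      rcases Finset.mem_insert.1 hj with rfl | hj
      · simpa [hg'] using ha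
      · rw [heq j hj]; exact hg.1.2 j hj
  have main : ∀ T ⊆ S, ∃ g₂, h (insert y T) = some g₂ ∧ TypeEq I ι (insert y T) g' g₂ := by
    intro T
    induction T using Finset.strongInduction with
    | H T ih =>
      intro hT
      refine Compatible.exists_label hh ⟨hprop.mono (Finset.insert_subset_insert y hT), ?_⟩
        (hfit T hT)
      intro U hU
      -- Proper subsets containing `y` fall under the induction hypothesis; the others lie in `S`,
      -- where the old local isomorphism applies.
      by_cases hyU : y ∈ U
      · have h1 : U.erase y ⊆ T := by
          intro j hj
          exact (Finset.mem_insert.1 (hU.1 (Finset.mem_of_mem_erase hj))).resolve_left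
            (Finset.ne_of_mem_erase hj)
        have h2 : U.erase y ≠ T := by
          rintro rfl
          rw [Finset.insert_erase hyU] at hU
          exact hU.2 subset_rfl
        have := ih (U.erase y) (h1.ssubset_of_ne h2) (h1.trans hT)
        rwa [Finset.insert_erase hyU] at this
      · have h1 : U ⊆ S := by
          intro j hj
          exact hT ((Finset.mem_insert.1 (hU.1 hj)).resolve_left fun h => hyU (h ▸ hj))
        obtain ⟨-, g₂, h2, t2⟩ := hg.mono hh h1
        exact ⟨g₂, h2, (typeEq_of_eqOn fun j hj => heq j (h1 hj)).trans t2⟩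
  exact ⟨y, hyS, hprop, main S subset_rfl⟩

end Labelling

/-! ### Basic facts on formulas -/

namespace Formula

theorem fv_exs (xs : List ℕ) (φ : Formula) : (exs xs φ).fv = φ.fv \ xs.toFinset := by
  induction xs with
  | nil => simp [exs]
  | cons x xs ih =>
    change (exs xs φ).fv.erase x = _
    rw [ih]
    ext y
    simp
    tauto

theorem fv_alls (xs : List ℕ) (φ : Formula) : (alls xs φ).fv = φ.fv \ xs.toFinset := by
  induction xs with
  | nil => simp [alls]
  | cons x xs ih =>
    change (alls xs φ).fv.erase x = _
    rw [ih]
    ext y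
    simp
    tauto

theorem rels_exs (xs : List ℕ) (φ : Formula) : (exs xs φ).rels = φ.rels := by
  induction xs with
  | nil => rfl
  | cons x xs ih => exact ih

theorem rels_alls (xs : List ℕ) (φ : Formula) : (alls xs φ).rels = φ.rels := by
  induction xs with
  | nil => rfl
  | cons x xs ih => exact ih

theorem consts_exs (xs : List ℕ) (φ : Formula) : (exs xs φ).consts = φ.consts := by
  induction xs with
  | nil => rfl
  | cons x xs ih => exact ih

theorem consts_alls (xs : List ℕ) (φ : Formula) : (alls xs φ).consts = φ.consts := by
  induction xs with
  | nil => rfl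
  | cons x xs ih => exact ih

theorem blockSubformulasAux_subset_exs (b : Bool) (xs : List ℕ) (γ ψ : Formula) :
    blockSubformulasAux false ψ ⊆ blockSubformulasAux b (exs xs (and γ ψ)) := by
  induction xs generalizing b with
  | nil => simp [exs, blockSubformulasAux]
  | cons x xs ih => exact (ih true).trans Finset.subset_union_right

theorem blockSubformulasAux_subset_alls (b : Bool) (xs : List ℕ) (γ ψ : Formula) :
    blockSubformulasAux false ψ ⊆ blockSubformulasAux b (alls xs (imp γ ψ)) := by
  induction xs generalizing b with
  | nil => simp [alls, blockSubformulasAux]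
  | cons x xs ih => exact (ih true).trans Finset.subset_union_right

/-- The bound `2 ≤ k` is for equality guards, which may have two variables whatever the arities. -/
theorem IsAtom.card_fv_le {γ : Formula} (hγ : IsAtom γ) {k : ℕ} (hk : 2 ≤ k)
    (hr : ∀ R ∈ γ.rels, R.arity ≤ k) : γ.fv.card ≤ k := by
  have ht : ∀ t : Term, t.fv.card ≤ 1 := by rintro (x | c) <;> simp [Term.fv]
  cases hγ with
  | eq s t =>
    have h1 := Finset.card_union_le s.fv t.fv
    have h2 := ht s
    have h3 := ht t
    change (s.fv ∪ t.fv).card ≤ k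
    omega
  | rel R ts =>
    have h1 : R.arity ≤ k := hr R (by simp [rels])
    have h2 : (Finset.univ.biUnion fun i => (ts i).fv).card ≤ ∑ _i : Fin R.arity, 1 :=
      Finset.card_biUnion_le.trans (Finset.sum_le_sum fun i _ => ht _)
    simp only [Finset.sum_const, Finset.card_univ, Fintype.card_fin, smul_eq_mul, mul_one] at h2
    exact h2.trans h1

end Formula

/-! ### Truth under assignments, and the expansion recording quantified subformulas -/

namespace Struc

variable {A : Type} (M : Struc A)

theorem val_congr {v v' : ℕ → A} {t : Term} (h : ∀ x ∈ t.fv, v x = v' x) :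
    M.val v t = M.val v' t := by
  cases t with
  | var x => exact h x (by simp [Term.fv])
  | const c => rfl

theorem sat_congr {φ : Formula} {v v' : ℕ → A} (h : ∀ x ∈ φ.fv, v x = v' x) :
    M.Sat v φ ↔ M.Sat v' φ := by
  induction φ generalizing v v' with
  | bot => rfl
  | top => rfl
  | eq s t =>
    simp only [Formula.fv, Finset.mem_union] at h
    simp only [Sat, M.val_congr fun x hx => h x (Or.inl hx),
      M.val_congr fun x hx => h x (Or.inr hx)]
  | rel R ts =>
    have : (fun i => M.val v (ts i)) = fun i => M.val v' (ts i) := funext fun i =>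
      M.val_congr fun x hx => h x (Finset.mem_biUnion.2 ⟨i, Finset.mem_univ _, hx⟩)
    simp only [Sat, this]
  | not φ ih => exact not_congr (ih h)
  | and φ ψ ih1 ih2 | or φ ψ ih1 ih2 | imp φ ψ ih1 ih2 | iff φ ψ ih1 ih2 =>
    simp only [Formula.fv, Finset.mem_union] at h
    simp only [Sat, ih1 fun x hx => h x (Or.inl hx), ih2 fun x hx => h x (Or.inr hx)]
  | all x φ ih =>
    refine forall_congr' fun a => ih fun y hy => ?_
    by_cases hxy : y = x
    · simp [hxy]
    · simpa [hxy] using h y (Finset.mem_erase.2 ⟨hxy, hy⟩)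
  | ex x φ ih =>
    refine exists_congr fun a => ih fun y hy => ?_
    by_cases hxy : y = x
    · simp [hxy]
    · simpa [hxy] using h y (Finset.mem_erase.2 ⟨hxy, hy⟩)

theorem sat_exs (xs : List ℕ) (φ : Formula) (v : ℕ → A) :
    M.Sat v (Formula.exs xs φ) ↔ ∃ v', (∀ x ∉ xs, v' x = v x) ∧ M.Sat v' φ := by
  induction xs generalizing v with
  | nil =>
    refine ⟨fun h => ⟨v, fun _ _ => rfl, h⟩, ?_⟩
    rintro ⟨v', h, h'⟩
    obtain rfl : v' = v := funext fun x => h x (by simp)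
    exact h'
  | cons y xs ih =>
    change (∃ a, M.Sat (Function.update v y a) (Formula.exs xs φ)) ↔ _
    simp only [ih]
    constructor
    · rintro ⟨a, v', h, h'⟩
      refine ⟨v', fun x hx => ?_, h'⟩
      simp only [List.mem_cons, not_or] at hx
      rw [h x hx.2, Function.update_of_ne hx.1]
    · rintro ⟨v', h, h'⟩
      refine ⟨v' y, v', fun x hx => ?_, h'⟩
      by_cases hxy : x = y
      · simp [hxy]
      · rw [Function.update_of_ne hxy]
        exact h x (by simp [hxy, hx])

theorem sat_alls_imp (xs : List ℕ) (γ ψ : Formula) (v : ℕ → A) :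
    M.Sat v (Formula.alls xs (.imp γ ψ)) ↔ ¬ M.Sat v (Formula.exs xs (.and γ (.not ψ))) := by
  induction xs generalizing v with
  | nil => simp [Formula.alls, Formula.exs, Sat]
  | cons y xs ih =>
    change (∀ a, M.Sat (Function.update v y a) (Formula.alls xs (.imp γ ψ))) ↔
      ¬ ∃ a, M.Sat (Function.update v y a) (Formula.exs xs (.and γ (.not ψ)))
    simp only [ih, not_exists]

/-- The expansion of a structure to the normal-form signature, with `R_χ` interpreted by `χ`. -/
def nfInterp (φ : Formula) : ∀ R : (nfSignature φ).Rels,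
    (Fin ((nfSignature φ).ar R) → A) → Prop
  | .inl R, f => M.relI R.1 f
  | .inr χ, f => M.Sat
      -- The value off the free variables is a default without influence on the truth of χ.
      (fun x => if hx : x ∈ χ.1.fv then f (χ.1.fv.equivFin ⟨x, hx⟩) else M.constI 0) χ.1

theorem nfInterp_block (φ : Formula)
    (χ : {χ // χ ∈ φ.blockSubformulas.filter fun χ : Formula => ¬ χ.fv = ∅}) (u : ℕ → A) :
    M.nfInterp φ (.inr χ) (fun i => u (χ.1.fv.equivFin.symm i).1) ↔ M.Sat u χ.1 := by
  refine M.sat_congr fun x hx => ?_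
  rw [dif_pos hx]
  simp

/-- The interpretations of the constant symbols of `φ`. -/
abbrev ConstElem (φ : Formula) : Type := {a : A // ∃ c ∈ φ.consts, M.constI c = a}

instance finite_constElem (φ : Formula) : Finite (M.ConstElem φ) :=
  Set.Finite.to_subtype (φ.consts.finite_toSet.image M.constI)

theorem card_constElem_le (φ : Formula) : Nat.card (M.ConstElem φ) ≤ φ.consts.card := by
  classical
  have : Function.Surjective (fun c : φ.consts => (⟨M.constI c, c, c.2, rfl⟩ : M.ConstElem φ)) := by
    rintro ⟨_, c, hc, rfl⟩
    exact ⟨⟨c, hc⟩, rfl⟩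
  simpa using Nat.card_le_card_of_surjective _ this

open Classical in
/-- The structure read off from a labelling, over the symbols of `φ`. -/
noncomputable def labelStruc (φ : Formula) {n : ℕ} (h : Finset (Fin n) → Option (Fin n → A))
    (j₀ : Fin n) : Struc (Fin n ⊕ M.ConstElem φ) where
  -- The relations R_χ influence the labels but are not part of the finite structure itself.
  relI R args := ∃ hR : R ∈ φ.rels, labelRel (ar := (nfSignature φ).ar) (M.nfInterp φ)
    (Subtype.val : M.ConstElem φ → A) h (.inl ⟨R, hR⟩) args
  constI c := if hc : c ∈ φ.consts then .inr ⟨M.constI c, c, hc, rfl⟩ else .inl j₀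

end Struc

/-! ### Truth of guarded formulas under local isomorphisms -/

/-- The element `b` belongs to `S ∪ K`. -/
def Within {n : ℕ} {K : Type} (S : Finset (Fin n)) (b : Fin n ⊕ K) : Prop :=
  ∀ j, b = Sum.inl j → j ∈ S

theorem Proper.elim_inj {n : ℕ} {A : Type} {p : A → Prop} {S : Finset (Fin n)} {g : Fin n → A}
    (hg : Proper (Subtype.val : {a // p a} → A) S g) {b b' : Fin n ⊕ {a // p a}}
    (hb : Within S b) (hb' : Within S b') :
    Sum.elim g Subtype.val b = Sum.elim g Subtype.val b' ↔ b = b' := by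
  refine ⟨fun h => ?_, fun h => h ▸ rfl⟩
  rcases b with j | c <;> rcases b' with j' | c'
  · exact congrArg _ (hg.1 (hb j rfl) (hb' j' rfl) h)
  · exact absurd ⟨c', h.symm⟩ (hg.2 j (hb j rfl))
  · exact absurd ⟨c, h⟩ (hg.2 j' (hb' j' rfl))
  · exact congrArg _ (Subtype.ext h)

section Transfer

variable {A : Type} {M : Struc A} {φ : Formula} {n m : ℕ}
  {ω : ∀ R, (Fin ((nfSignature φ).ar R) → Fin n ⊕ M.ConstElem φ) → Prop}
  {h : Finset (Fin n) → Option (Fin n → A)} {j₀ : Fin n}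

/-- Local isomorphisms from `M.labelStruc φ h j₀` to `M`. -/
abbrev LocIso (M : Struc A) (φ : Formula) (h : Finset (Fin n) → Option (Fin n → A))
    (S : Finset (Fin n)) (g : Fin n → A) : Prop :=
  LocalIso (ar := (nfSignature φ).ar) (M.nfInterp φ) (Subtype.val : M.ConstElem φ → A) h S g

/-- The assignment into `M` induced by `g`. -/
abbrev push (M : Struc A) (φ : Formula) (g : Fin n → A) (v : ℕ → Fin n ⊕ M.ConstElem φ) : ℕ → A :=
  fun x => Sum.elim g Subtype.val (v x)

theorem elim_val {t : Term} (ht : t.consts ⊆ φ.consts) (g : Fin n → A)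
    (v : ℕ → Fin n ⊕ M.ConstElem φ) :
    Sum.elim g Subtype.val ((M.labelStruc φ h j₀).val v t) = M.val (push M φ g v) t := by
  cases t with
  | var x => rfl
  | const c =>
    have hc : c ∈ φ.consts := ht (by simp [Term.consts])
    simp [Struc.val, Struc.labelStruc, hc]

theorem within_val {t : Term} (ht : t.consts ⊆ φ.consts) {S : Finset (Fin n)}
    {v : ℕ → Fin n ⊕ M.ConstElem φ} (hv : ∀ x ∈ t.fv, Within S (v x)) :
    Within S ((M.labelStruc φ h j₀).val v t) := by
  cases t with
  | var x => exact hv x (by simp [Term.fv])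
  | const c =>
    have hc : c ∈ φ.consts := ht (by simp [Term.consts])
    simp [Struc.val, Struc.labelStruc, hc, Within]

/-- Equalities transfer because local isomorphisms are injective and avoid the constants, relational
atoms because the structure is read off from the labels. -/
theorem sat_atom_iff (hh : IsLabelling (ar := (nfSignature φ).ar) (M.nfInterp φ) Subtype.val ω h)
    {γ : Formula} (hγ : γ.IsAtom) (hr : γ.rels ⊆ φ.rels) (hc : γ.consts ⊆ φ.consts)
    {S : Finset (Fin n)} {g : Fin n → A} {v : ℕ → Fin n ⊕ M.ConstElem φ}
    (hg : LocIso M φ h S g) (hv : ∀ x ∈ γ.fv, Within S (v x)) :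
    (M.labelStruc φ h j₀).Sat v γ ↔ M.Sat (push M φ g v) γ := by
  cases hγ with
  | eq s t =>
    simp only [Formula.fv, Finset.mem_union] at hv
    have hs : s.consts ⊆ φ.consts := Finset.subset_union_left.trans hc
    have ht : t.consts ⊆ φ.consts := Finset.subset_union_right.trans hc
    simp only [Struc.Sat]
    rw [← elim_val (h := h) (j₀ := j₀) hs, ← elim_val (h := h) (j₀ := j₀) ht]
    exact (hg.1.elim_inj (within_val hs fun x hx => hv x (Or.inl hx))
      (within_val ht fun x hx => hv x (Or.inr hx))).symm
  | rel R ts =>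
    have hR : R ∈ φ.rels := hr (by simp [Formula.rels])
    have hts : ∀ i, (ts i).consts ⊆ φ.consts := fun i =>
      (Finset.subset_biUnion_of_mem (fun i => (ts i).consts) (Finset.mem_univ i)).trans hc
    have hw : ∀ i, Within S ((M.labelStruc φ h j₀).val v (ts i)) := fun i =>
      within_val (hts i) fun x hx => hv x (Finset.mem_biUnion.2 ⟨i, Finset.mem_univ _, hx⟩)
    have key := hg.labelRel_iff hh (.inl ⟨R, hR⟩)
      (fun i => (M.labelStruc φ h j₀).val v (ts i)) (by
        intro j hj
        obtain ⟨i, hi⟩ := mem_support.1 hj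
        exact hw i j hi)
    have e : (fun i => M.val (push M φ g v) (ts i)) =
        fun i => Sum.elim g Subtype.val ((M.labelStruc φ h j₀).val v (ts i)) :=
      funext fun i => (elim_val (hts i) g v).symm
    simp only [Struc.Sat]
    rw [e]
    exact ⟨fun ⟨_, hl⟩ => key.1 hl, fun hI => ⟨hR, key.2 hI⟩⟩

theorem exists_locIso_within
    (hh : IsLabelling (ar := (nfSignature φ).ar) (M.nfInterp φ) Subtype.val ω h)
    {a : A} (ha : ∀ c ∈ φ.consts, M.constI c ≠ a) (b : Fin n ⊕ M.ConstElem φ) :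
    ∃ S g, LocIso M φ h S g ∧ Within S b := by
  rcases b with j | c
  · obtain ⟨g, hg⟩ := exists_localIso_singleton hh (a := a)
      (by rintro ⟨⟨_, c, hc, rfl⟩, rfl⟩; exact ha c hc rfl) j
    exact ⟨{j}, g, hg, fun i hi => by simpa using (Sum.inl.inj hi).symm⟩
  · exact ⟨∅, fun _ => a, localIso_empty hh _, fun i hi => by simp at hi⟩

/-- A relational guard holds only through a label of its support. An equality guard confines its
variables to one element, which is a constant or a labelled singleton; the unnamed element `a` of
the model guarantees that singletons have labels. -/
theorem exists_locIso_of_sat_atom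
    (hh : IsLabelling (ar := (nfSignature φ).ar) (M.nfInterp φ) Subtype.val ω h)
    {a : A} (ha : ∀ c ∈ φ.consts, M.constI c ≠ a) {γ : Formula} (hγ : γ.IsAtom)
    (hc : γ.consts ⊆ φ.consts)
    {v : ℕ → Fin n ⊕ M.ConstElem φ} (hv : (M.labelStruc φ h j₀).Sat v γ) :
    ∃ S g, LocIso M φ h S g ∧ ∀ x ∈ γ.fv, Within S (v x) := by
  cases hγ with
  | eq s t =>
    simp only [Struc.Sat] at hv
    obtain ⟨S, g, hg, hS⟩ := exists_locIso_within hh ha ((M.labelStruc φ h j₀).val v s)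
    refine ⟨S, g, hg, fun x hx => ?_⟩
    rcases Finset.mem_union.1 hx with hx | hx
    · cases s with
      | var y => simp only [Term.fv, Finset.mem_singleton] at hx; subst hx; exact hS
      | const c => simp [Term.fv] at hx
    · rw [hv] at hS
      cases t with
      | var y => simp only [Term.fv, Finset.mem_singleton] at hx; subst hx; exact hS
      | const c => simp [Term.fv] at hx
  | rel R ts =>
    obtain ⟨hR, hl⟩ := hv
    obtain ⟨g, hg⟩ := localIso_of_labelRel hh hl
    refine ⟨_, g, hg, fun x hx j hj => ?_⟩
    obtain ⟨i, -, hi⟩ := Finset.mem_biUnion.1 hx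
    refine mem_support.2 ⟨i, ?_⟩
    cases hti : ts i with
    | var y =>
      simp only [hti, Term.fv, Finset.mem_singleton] at hi
      subst hi
      exact hj
    | const c => simp [hti, Term.fv] at hi

/-- The variables of `G` outside `F` are added one at a time. To keep the domain at most `m` before
each extension, it is first cut down to the points that `v` takes on `F`, and then never exceeds the
number of variables treated. -/
theorem exists_lift (hh : IsLabelling (ar := (nfSignature φ).ar) (M.nfInterp φ) Subtype.val ω h)
    (hω : HasExtensions (nfSignature φ).ar m n ω) (hmn : m ≤ n) {F G : Finset ℕ} (hFG : F ⊆ G)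
    (hG : G.card ≤ m + 1) {S : Finset (Fin n)} {g : Fin n → A} (hg : LocIso M φ h S g)
    {v : ℕ → Fin n ⊕ M.ConstElem φ} (hv : ∀ x ∈ F, Within S (v x)) {u : ℕ → A}
    (hu : ∀ x ∈ F, push M φ g v x = u x) :
    ∃ S' g', LocIso M φ h S' g' ∧ ∃ v' : ℕ → Fin n ⊕ M.ConstElem φ,
      (∀ x ∈ G, Within S' (v' x)) ∧ (∀ x ∈ F, v' x = v x) ∧
      ∀ x ∈ G, push M φ g' v' x = u x := by
  classical
  suffices H : ∀ W ⊆ G, F ⊆ W → ∃ S' g', LocIso M φ h S' g' ∧ S'.card ≤ W.card ∧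
      ∃ v' : ℕ → Fin n ⊕ M.ConstElem φ, (∀ x ∈ W, Within S' (v' x)) ∧ (∀ x ∈ F, v' x = v x) ∧
      ∀ x ∈ W, push M φ g' v' x = u x by
    obtain ⟨S', g', h1, -, h2⟩ := H G subset_rfl hFG
    exact ⟨S', g', h1, h2⟩
  intro W hWG hFW
  obtain ⟨U, rfl⟩ : ∃ U, W = F ∪ U := ⟨W, (Finset.union_eq_right.2 hFW).symm⟩
  clear hFW
  induction U using Finset.induction_on with
  | empty =>
    rw [Finset.union_empty]
    let T : Finset (Fin n) := Finset.univ.filter fun j => ∃ x ∈ F, v x = Sum.inl j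
    have hT : ∀ j, j ∈ T ↔ ∃ x ∈ F, v x = Sum.inl j := by simp [T]
    have hTS : T ⊆ S := fun j hj => by
      obtain ⟨x, hx, hxj⟩ := (hT j).1 hj
      exact hv x hx j hxj
    refine ⟨T, g, hg.mono hh hTS, ?_, v, fun x hx j hj => (hT j).2 ⟨x, hx, hj⟩,
      fun _ _ => rfl, hu⟩
    have h1 : T.image (Sum.inl : Fin n → Fin n ⊕ M.ConstElem φ) ⊆ F.image v := by
      intro b hb
      obtain ⟨j, hj, rfl⟩ := Finset.mem_image.1 hb
      obtain ⟨x, hx, hxj⟩ := (hT j).1 hj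
      exact Finset.mem_image.2 ⟨x, hx, hxj⟩
    have h2 := Finset.card_le_card h1
    rw [Finset.card_image_of_injective _ Sum.inl_injective] at h2
    exact h2.trans Finset.card_image_le
  | insert y U _ ih =>
    rw [Finset.union_insert] at hWG ⊢
    obtain ⟨S', g', h1, hcard, v', h2, h3, h4⟩ := ih ((Finset.subset_insert _ _).trans hWG)
    by_cases hy : y ∈ F ∪ U
    · rw [Finset.insert_eq_of_mem hy]
      exact ⟨S', g', h1, hcard, v', h2, h3, h4⟩
    have hcard' : (insert y (F ∪ U)).card = (F ∪ U).card + 1 := Finset.card_insert_of_notMem hy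
    have hlt : (F ∪ U).card ≤ m := by
      have := Finset.card_le_card hWG
      omega
    -- The value `u y` is named by a constant, already attained on `S'`, or new; only a new value
    -- costs a point.
    suffices H : ∃ T g'', LocIso M φ h T g'' ∧ S' ⊆ T ∧ T.card ≤ S'.card + 1 ∧
        (∀ j ∈ S', g'' j = g' j) ∧ ∃ b : Fin n ⊕ M.ConstElem φ, Within T b ∧
          Sum.elim g'' Subtype.val b = u y by
      obtain ⟨T, g'', k1, k2, k3, k4, b, k5, k6⟩ := H
      refine ⟨T, g'', k1, by omega, Function.update v' y b, ?_, ?_, ?_⟩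
      · intro x hx
        by_cases hxy : x = y
        · subst hxy; simpa using k5
        · rw [Function.update_of_ne hxy]
          exact fun j hj => k2 (h2 x ((Finset.mem_insert.1 hx).resolve_left hxy) j hj)
      · intro x hx
        have hxy : x ≠ y := fun e => hy (e ▸ Finset.mem_union_left _ hx)
        rw [Function.update_of_ne hxy, h3 x hx]
      · intro x hx
        by_cases hxy : x = y
        · subst hxy; simpa [push] using k6
        · have hx' := (Finset.mem_insert.1 hx).resolve_left hxy
          simp only [push, Function.update_of_ne hxy]
          rw [← h4 x hx']
          simp only [push]
          rcases hb : v' x with j | c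
          · exact k4 j (h2 x hx' j hb)
          · rfl
    by_cases hc : ∃ c ∈ φ.consts, M.constI c = u y
    · exact ⟨S', g', h1, subset_rfl, by omega, fun _ _ => rfl, Sum.inr ⟨u y, hc⟩,
        fun j hj => by simp at hj, rfl⟩
    by_cases hs : ∃ j ∈ S', g' j = u y
    · obtain ⟨j, hj, hju⟩ := hs
      exact ⟨S', g', h1, subset_rfl, by omega, fun _ _ => rfl, Sum.inl j,
        fun i hi => Sum.inl.inj hi ▸ hj, hju⟩
    push Not at hs
    obtain ⟨z, hz, hz'⟩ := h1.extend hh hω hmn (hcard.trans hlt) (a := u y)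
      (by rintro ⟨⟨_, hc'⟩, rfl⟩; exact hc hc') hs
    refine ⟨_, _, hz', Finset.subset_insert _ _, Finset.card_insert_le _ _, ?_, Sum.inl z, ?_, ?_⟩
    · exact fun j hj => Function.update_of_ne (fun e : j = z => hz (e ▸ hj)) _ _
    · exact fun i hi => Sum.inl.inj hi ▸ Finset.mem_insert_self _ _
    · simp

/-- Both sides equal the value of R_χ, read off from the labels at the same tuple of the finite
structure, whichever local isomorphism is used. -/
theorem sat_block_iff_of_locIso
    (hh : IsLabelling (ar := (nfSignature φ).ar) (M.nfInterp φ) Subtype.val ω h)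
    {χ : Formula} (hχ : χ ∈ φ.blockSubformulas) {S S' : Finset (Fin n)} {g g' : Fin n → A}
    (hg : LocIso M φ h S g) (hg' : LocIso M φ h S' g') {v v' : ℕ → Fin n ⊕ M.ConstElem φ}
    (hv : ∀ x ∈ χ.fv, Within S (v x)) (hv' : ∀ x ∈ χ.fv, Within S' (v' x))
    (hvv' : ∀ x ∈ χ.fv, v x = v' x) :
    M.Sat (push M φ g v) χ ↔ M.Sat (push M φ g' v') χ := by
  by_cases hfv : χ.fv = ∅
  · exact M.sat_congr (by simp [hfv])
  let X : {χ // χ ∈ φ.blockSubformulas.filter fun χ : Formula => ¬ χ.fv = ∅} :=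
    ⟨χ, Finset.mem_filter.2 ⟨hχ, hfv⟩⟩
  have key : ∀ {S : Finset (Fin n)} {g : Fin n → A} {v : ℕ → Fin n ⊕ M.ConstElem φ},
      LocIso M φ h S g → (∀ x ∈ χ.fv, Within S (v x)) →
      (labelRel (ar := (nfSignature φ).ar) (M.nfInterp φ) Subtype.val h (.inr X)
        (fun i => v (χ.fv.equivFin.symm i).1) ↔ M.Sat (push M φ g v) χ) := by
    intro S g v hg hv
    rw [← M.nfInterp_block φ X]
    refine hg.labelRel_iff hh (.inr X) _ fun j hj => ?_
    obtain ⟨i, hi⟩ := mem_support.1 hj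
    exact hv _ (χ.fv.equivFin.symm i).2 j hi
  rw [← key hg hv, ← key hg' hv']
  have : (fun i => v (χ.fv.equivFin.symm i).1) = fun i => v' (χ.fv.equivFin.symm i).1 :=
    funext fun i => hvv' _ (χ.fv.equivFin.symm i).2
  exact iff_of_eq (congrArg (labelRel (ar := (nfSignature φ).ar) (M.nfInterp φ) Subtype.val h
    (.inr X)) this)

/-- The invariance `hinv` is assumed rather than derived, so that the result also serves universal
blocks with `θ` a negation: there the existential formula is not itself a block subformula. -/
theorem sat_guarded_ex_iff
    (hh : IsLabelling (ar := (nfSignature φ).ar) (M.nfInterp φ) Subtype.val ω h)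
    (hω : HasExtensions (nfSignature φ).ar m n ω) (hmn : m ≤ n)
    {a : A} (ha : ∀ c ∈ φ.consts, M.constI c ≠ a) {γ : Formula} (hγ : γ.IsAtom)
    (hr : γ.rels ⊆ φ.rels) (hc : γ.consts ⊆ φ.consts) (hcard : γ.fv.card ≤ m + 1)
    {θ : Formula} (hθ : θ.fv ⊆ γ.fv)
    (ih : ∀ {S g} {v : ℕ → Fin n ⊕ M.ConstElem φ}, LocIso M φ h S g →
      (∀ x ∈ θ.fv, Within S (v x)) →
      ((M.labelStruc φ h j₀).Sat v θ ↔ M.Sat (push M φ g v) θ))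
    (xs : List ℕ)
    (hinv : ∀ {S S' g g'} {v v' : ℕ → Fin n ⊕ M.ConstElem φ}, LocIso M φ h S g →
      LocIso M φ h S' g' → (∀ x ∈ γ.fv \ xs.toFinset, Within S (v x)) →
      (∀ x ∈ γ.fv \ xs.toFinset, Within S' (v' x)) →
      (∀ x ∈ γ.fv \ xs.toFinset, v x = v' x) →
      (M.Sat (push M φ g v) (.exs xs (.and γ θ)) ↔
        M.Sat (push M φ g' v') (.exs xs (.and γ θ))))
    {S : Finset (Fin n)} {g : Fin n → A} {v : ℕ → Fin n ⊕ M.ConstElem φ}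
    (hg : LocIso M φ h S g) (hv : ∀ x ∈ γ.fv \ xs.toFinset, Within S (v x)) :
    (M.labelStruc φ h j₀).Sat v (.exs xs (.and γ θ)) ↔
      M.Sat (push M φ g v) (.exs xs (.and γ θ)) := by
  classical
  have hbody : ∀ {S g} {v : ℕ → Fin n ⊕ M.ConstElem φ}, LocIso M φ h S g →
      (∀ x ∈ γ.fv, Within S (v x)) →
      ((M.labelStruc φ h j₀).Sat v (.and γ θ) ↔ M.Sat (push M φ g v) (.and γ θ)) :=
    fun hg hv => and_congr (sat_atom_iff hh hγ hr hc hg hv) (ih hg fun x hx => hv x (hθ hx))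
  constructor
  · intro hN
    obtain ⟨v', hv', hsat⟩ := (Struc.sat_exs _ _ _ _).1 hN
    obtain ⟨S', g', hg', hw⟩ := exists_locIso_of_sat_atom hh ha hγ hc hsat.1
    have hM : M.Sat (push M φ g' v') (.exs xs (.and γ θ)) :=
      (M.sat_exs _ _ _).2 ⟨_, fun _ _ => rfl, (hbody hg' hw).1 hsat⟩
    -- The guard supplies its own local isomorphism `g'`, unrelated to `g`; invariance carries the
    -- truth back to `g`.
    refine (hinv hg' hg (fun x hx => hw x (Finset.mem_sdiff.1 hx).1) hv fun x hx => ?_).1 hM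
    exact hv' x (by simpa using (Finset.mem_sdiff.1 hx).2)
  · intro hM
    obtain ⟨u, hu, hsat⟩ := (M.sat_exs _ _ _).1 hM
    obtain ⟨S', g', hg', v', k1, k2, k3⟩ := exists_lift hh hω hmn Finset.sdiff_subset hcard hg hv
      (u := u) fun x hx => (hu x (by simpa using (Finset.mem_sdiff.1 hx).2)).symm
    have hN : (M.labelStruc φ h j₀).Sat v' (.and γ θ) := by
      refine (hbody hg' k1).2 ((M.sat_congr fun x hx => ?_).2 hsat)
      refine k3 x ?_
      rcases Finset.mem_union.1 hx with hx | hx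
      · exact hx
      · exact hθ hx
    refine (Struc.sat_exs _ _ _ _).2 ⟨fun x => if x ∈ xs then v' x else v x,
      fun x hx => if_neg hx, (Struc.sat_congr _ fun x hx => ?_).2 hN⟩
    by_cases hxs : x ∈ xs
    · exact if_pos hxs
    · have hx' : x ∈ γ.fv := by
        rcases Finset.mem_union.1 hx with hx | hx
        · exact hx
        · exact hθ hx
      rw [if_neg hxs, k2 x (Finset.mem_sdiff.2 ⟨hx', by simpa using hxs⟩)]

theorem sat_iff_of_isGF
    (hh : IsLabelling (ar := (nfSignature φ).ar) (M.nfInterp φ) Subtype.val ω h)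
    (hω : HasExtensions (nfSignature φ).ar m n ω) (hmn : m ≤ n) (hm : 1 ≤ m)
    (har : ∀ R ∈ φ.rels, R.arity ≤ m + 1)
    {a : A} (ha : ∀ c ∈ φ.consts, M.constI c ≠ a) {ψ : Formula} (hψ : ψ.IsGF)
    (hr : ψ.rels ⊆ φ.rels) (hc : ψ.consts ⊆ φ.consts)
    (hb : Formula.blockSubformulasAux false ψ ⊆ φ.blockSubformulas)
    {S : Finset (Fin n)} {g : Fin n → A} {v : ℕ → Fin n ⊕ M.ConstElem φ}
    (hg : LocIso M φ h S g) (hv : ∀ x ∈ ψ.fv, Within S (v x)) :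
    (M.labelStruc φ h j₀).Sat v ψ ↔ M.Sat (push M φ g v) ψ := by
  have hcard : ∀ {γ : Formula}, γ.IsAtom → γ.rels ⊆ φ.rels → γ.fv.card ≤ m + 1 :=
    fun hγ hr => hγ.card_fv_le (by omega) fun R hR => har R (hr hR)
  induction hψ generalizing S g v with
  | bot => rfl
  | top => rfl
  | atom hγ => exact sat_atom_iff hh hγ hr hc hg hv
  | not _ ih => exact not_congr (ih hr hc hb hg hv)
  | and _ _ ih1 ih2 | or _ _ ih1 ih2 | imp _ _ ih1 ih2 | iff _ _ ih1 ih2 =>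
    obtain ⟨hr1, hr2⟩ := Finset.union_subset_iff.1 hr
    obtain ⟨hc1, hc2⟩ := Finset.union_subset_iff.1 hc
    obtain ⟨hb1, hb2⟩ := Finset.union_subset_iff.1 hb
    simp only [Struc.Sat, ih1 hr1 hc1 hb1 hg fun x hx => hv x (Finset.mem_union_left _ hx),
      ih2 hr2 hc2 hb2 hg fun x hx => hv x (Finset.mem_union_right _ hx)]
  | @exs xs γ ψ hγ _ hfv hxs ih =>
    rw [Formula.rels_exs] at hr
    rw [Formula.consts_exs] at hc
    obtain ⟨hr1, hr2⟩ := Finset.union_subset_iff.1 hr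
    obtain ⟨hc1, hc2⟩ := Finset.union_subset_iff.1 hc
    have hF : (Formula.exs xs (.and γ ψ)).fv = γ.fv \ xs.toFinset := by
      rw [Formula.fv_exs, Formula.fv, Finset.union_eq_left.2 hfv]
    have ih' := @ih hr2 hc2 ((Formula.blockSubformulasAux_subset_exs _ _ _ _).trans hb)
    cases xs with
    -- An empty block is a plain conjunction: it has no relation R_χ and needs none.
    | nil =>
      change ∀ x ∈ γ.fv ∪ ψ.fv, _ at hv
      exact and_congr (sat_atom_iff hh hγ hr1 hc1 hg fun x hx => hv x (Finset.mem_union_left _ hx))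
        (ih' hg fun x hx => hv x (Finset.mem_union_right _ hx))
    | cons y xs =>
      have hχ : Formula.exs (y :: xs) (.and γ ψ) ∈ φ.blockSubformulas :=
        hb (by simp [Formula.exs, Formula.blockSubformulasAux])
      rw [hF] at hv
      refine sat_guarded_ex_iff hh hω hmn ha hγ hr1 hc1 (hcard hγ hr1) hfv ih' _ ?_ hg hv
      rw [← hF]
      exact fun k1 k2 k3 k4 k5 => sat_block_iff_of_locIso hh hχ k1 k2 k3 k4 k5
  | @alls xs γ ψ hγ _ hfv hxs ih =>
    rw [Formula.rels_alls] at hr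
    rw [Formula.consts_alls] at hc
    obtain ⟨hr1, hr2⟩ := Finset.union_subset_iff.1 hr
    obtain ⟨hc1, hc2⟩ := Finset.union_subset_iff.1 hc
    have hF : (Formula.alls xs (.imp γ ψ)).fv = γ.fv \ xs.toFinset := by
      rw [Formula.fv_alls, Formula.fv, Finset.union_eq_left.2 hfv]
    have ih' := @ih hr2 hc2 ((Formula.blockSubformulasAux_subset_alls _ _ _ _).trans hb)
    cases xs with
    | nil =>
      change ∀ x ∈ γ.fv ∪ ψ.fv, _ at hv
      exact imp_congr (sat_atom_iff hh hγ hr1 hc1 hg fun x hx => hv x (Finset.mem_union_left _ hx))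
        (ih' hg fun x hx => hv x (Finset.mem_union_right _ hx))
    | cons y xs =>
      have hχ : Formula.alls (y :: xs) (.imp γ ψ) ∈ φ.blockSubformulas :=
        hb (by simp [Formula.alls, Formula.blockSubformulasAux])
      rw [hF] at hv
      rw [Struc.sat_alls_imp, Struc.sat_alls_imp]
      refine not_congr (sat_guarded_ex_iff hh hω hmn ha hγ hr1 hc1 (hcard hγ hr1)
        (θ := .not ψ) hfv (fun hg hv => not_congr (ih' hg hv)) _ ?_ hg hv)
      rw [← hF]
      intro S S' g g' v v' k1 k2 k3 k4 k5
      have := sat_block_iff_of_locIso hh hχ k1 k2 k3 k4 k5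
      rw [Struc.sat_alls_imp, Struc.sat_alls_imp] at this
      exact not_iff_not.1 this

end Transfer

/-! ### Counting types -/

namespace Signature

variable (σ : Signature)

/-- Atoms as dependent pairs. -/
def atomEquiv (k : ℕ) : σ.Atom k ≃ Σ R : σ.Rels, (Fin (σ.ar R) → Fin k ⊕ σ.Cons) where
  toFun α := ⟨α.R, α.args⟩
  invFun p := ⟨p.1, p.2⟩
  left_inv _ := rfl
  right_inv _ := rfl

instance finite_atom (k : ℕ) : Finite (σ.Atom k) := by
  classical exact Finite.of_equiv _ (σ.atomEquiv k).symm

theorem card_atom (k : ℕ) :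
    Nat.card (σ.Atom k) = ∑ R, (k + Fintype.card σ.Cons) ^ σ.ar R := by
  classical
  rw [Nat.card_congr (σ.atomEquiv k), Nat.card_eq_fintype_card, Fintype.card_sigma]
  simp

instance finite_lit (k : ℕ) : Finite (σ.Lit k) := by
  refine Finite.of_surjective (α := σ.Atom k ⊕ σ.Atom k) (Sum.elim Lit.pos Lit.neg) ?_
  rintro (α | α)
  · exact ⟨.inl α, rfl⟩
  · exact ⟨.inr α, rfl⟩

/-- Any set of atoms, together with the negations of all others, is maximal consistent. -/
theorem two_pow_le_ncard_types (k : ℕ) : 2 ^ Nat.card (σ.Atom k) ≤ (σ.types k).ncard := by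
  let f : Set (σ.Atom k) → Set (σ.Lit k) := fun U =>
    {l | match l with
      | .pos α => α ∈ U
      | .neg α => α ∉ U}
  have hf : Function.Injective f := by
    intro U V h
    ext α
    exact Set.ext_iff.1 h (.pos α)
  have hr : Set.range f ⊆ σ.types k := by
    rintro _ ⟨U, rfl⟩
    refine ⟨fun α h => h.2 h.1, fun T hT hle => ?_⟩
    rintro (α | α) hα
    · by_contra h
      exact hT α ⟨hα, hle (show Lit.neg α ∈ f U from h)⟩
    · intro h
      exact hT α ⟨hle (show Lit.pos α ∈ f U from h), hα⟩
  have h1 := Set.ncard_le_ncard hr (Set.toFinite _)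
  rw [← Set.image_univ, Set.ncard_image_of_injective _ hf, Set.ncard_univ] at h1
  have h2 : Nat.card (Set (σ.Atom k)) = 2 ^ Nat.card (σ.Atom k) := by
    have : Nat.card (σ.Atom k → Prop) = _ := Nat.card_fun
    exact this.trans (by simp)
  omega

theorem ar_le_width (R : σ.Rels) : σ.ar R ≤ σ.width := Finset.le_sup (Finset.mem_univ R)

theorem exists_ar_eq_width (h : 0 < σ.width) : ∃ R, σ.ar R = σ.width := by
  have hne : (Finset.univ : Finset σ.Rels).Nonempty := by
    by_contra hne
    rw [Finset.not_nonempty_iff_eq_empty] at hne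
    simp [width, hne] at h
  obtain ⟨R, -, hR⟩ := Finset.exists_mem_eq_sup _ hne σ.ar
  exact ⟨R, hR.symm⟩

theorem width_add_card_le_card_atom (h : 0 < σ.width) :
    σ.width + Fintype.card σ.Cons ≤ Nat.card (σ.Atom σ.width) := by
  obtain ⟨R, hR⟩ := σ.exists_ar_eq_width h
  rw [card_atom]
  calc σ.width + Fintype.card σ.Cons
      ≤ (σ.width + Fintype.card σ.Cons) ^ σ.ar R := Nat.le_self_pow (by omega) _
    _ ≤ _ := Finset.single_le_sum (f := fun R => (σ.width + Fintype.card σ.Cons) ^ σ.ar R)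
        (fun _ _ => Nat.zero_le _) (Finset.mem_univ R)

end Signature

/-! ### Estimates -/

theorem two_mul_sub_one_pow_self_le {x : ℕ} (hx : 1 ≤ x) : 2 * (x - 1) ^ x ≤ x ^ x := by
  have hx' : (1 : ℝ) ≤ x := by exact_mod_cast hx
  have h1 := Real.one_sub_div_pow_le_exp_neg hx'
  have h2 : Real.exp (-1) ≤ 1 / 2 := by
    rw [Real.exp_neg, ← one_div]
    exact one_div_le_one_div_of_le two_pos (by linarith [Real.add_one_le_exp (1 : ℝ)])
  have h3 : ((x - 1 : ℕ) : ℝ) = x * (1 - 1 / x) := by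
    rw [Nat.cast_sub hx]
    field_simp
    simp
  have h4 : (2 * ((x - 1 : ℕ) : ℝ) ^ x) ≤ (x : ℝ) ^ x := by
    rw [h3, mul_pow]
    have : (0 : ℝ) ≤ (x : ℝ) ^ x := by positivity
    nlinarith [h1.trans h2]
  exact_mod_cast h4

/-- Since (1 - 2^(-d))^(2^d) ≤ 1/2, using 2^d L further points leaves a failure probability of at
most 2^(-L). With L = 16 N² this beats the number of pairs, which is at most 2^(3N² + 6N). -/
theorem extension_estimate {N d m : ℕ} (hd : d ≤ N) (hm : m + 1 ≤ N) :
    (m + 2 ^ d * (16 * N ^ 2)) ^ m * 2 ^ d * (2 ^ d - 1) ^ (m + 2 ^ d * (16 * N ^ 2) - m) <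
      2 ^ ((m + 2 ^ d * (16 * N ^ 2) - m) * d) := by
  rw [Nat.add_sub_cancel_left]
  set L := 16 * N ^ 2 with hL
  have h1 : 2 ^ L * (2 ^ d - 1) ^ (2 ^ d * L) ≤ 2 ^ (2 ^ d * L * d) := by
    have := Nat.pow_le_pow_left (two_mul_sub_one_pow_self_le (Nat.one_le_two_pow (n := d))) L
    calc 2 ^ L * (2 ^ d - 1) ^ (2 ^ d * L) = (2 * (2 ^ d - 1) ^ 2 ^ d) ^ L := by
          rw [mul_pow, ← pow_mul]
      _ ≤ ((2 ^ d) ^ 2 ^ d) ^ L := this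
      _ = _ := by rw [← pow_mul, ← pow_mul]; congr 1; ring
  have hN : N < 2 ^ N := Nat.lt_two_pow_self
  have h2 : m + 2 ^ d * L ≤ 2 ^ (5 + 3 * N) := by
    have h21 : m + 2 ^ d * L ≤ 2 ^ N * (17 * N ^ 2) := by
      have e1 : m ≤ 2 ^ N * N ^ 2 := by nlinarith [Nat.one_le_two_pow (n := N)]
      have e2 : 2 ^ d * L ≤ 2 ^ N * L := Nat.mul_le_mul_right _ (Nat.pow_le_pow_right two_pos hd)
      rw [hL] at e2 ⊢
      nlinarith
    have h22 : N ^ 2 ≤ (2 ^ N) ^ 2 := Nat.pow_le_pow_left hN.le 2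
    calc _ ≤ _ := h21
      _ ≤ 2 ^ N * (32 * (2 ^ N) ^ 2) := by gcongr; norm_num
      _ = _ := by rw [pow_add, pow_mul']; ring
  have h3 : (m + 2 ^ d * L) ^ m * 2 ^ d < 2 ^ L := by
    calc (m + 2 ^ d * L) ^ m * 2 ^ d ≤ (2 ^ (5 + 3 * N)) ^ N * 2 ^ N := by
          refine Nat.mul_le_mul ?_ (Nat.pow_le_pow_right two_pos hd)
          exact (Nat.pow_le_pow_left h2 m).trans (Nat.pow_le_pow_right (by positivity) (by omega))
      _ = 2 ^ ((5 + 3 * N) * N + N) := by rw [← pow_mul, ← pow_add]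
      _ < 2 ^ L := Nat.pow_lt_pow_right (by norm_num) (by rw [hL]; nlinarith)
  -- The factor vanishes when `d = 0`, and then the strict inequality cannot be obtained by
  -- multiplication.
  rcases Nat.eq_zero_or_pos ((2 ^ d - 1) ^ (2 ^ d * L)) with h0 | h0
  · rw [h0, mul_zero]
    positivity
  · exact (Nat.mul_lt_mul_of_pos_right h3 h0).trans_le h1

/-- `(1 - 1 / k) ^ k`, the limiting share of the atoms that avoid a given variable. -/
noncomputable def avoidRatio (k : ℕ) : ℝ := (1 + (-1) / k) ^ k

/-- Bernoulli's inequality with the real exponent k / t ≥ 1. -/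
theorem avoidRatio_mono {t k : ℕ} (ht : 2 ≤ t) (htk : t ≤ k) : avoidRatio t ≤ avoidRatio k := by
  have ht' : (2 : ℝ) ≤ t := by exact_mod_cast ht
  have hk' : (t : ℝ) ≤ k := by exact_mod_cast htk
  have hk0 : (0 : ℝ) < k := by linarith
  have hb : 0 ≤ 1 + (-1) / (k : ℝ) := by
    rw [neg_div]
    have : 1 / (k : ℝ) ≤ 1 := by rw [div_le_one hk0]; linarith
    linarith
  have h1 : 1 + (k / t : ℝ) * ((-1) / k) ≤ (1 + (-1) / (k : ℝ)) ^ (k / t : ℝ) :=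
    one_add_mul_self_le_rpow_one_add (by linarith) (by rw [le_div_iff₀] <;> linarith)
  have h2 : (k / t : ℝ) * ((-1) / k) = (-1) / t := by field_simp
  rw [h2] at h1
  have h0 : 0 ≤ 1 + (-1) / (t : ℝ) := by
    rw [neg_div]
    have : 1 / (t : ℝ) ≤ 1 := by rw [div_le_one] <;> linarith
    linarith
  calc avoidRatio t ≤ ((1 + (-1) / (k : ℝ)) ^ (k / t : ℝ)) ^ t := pow_le_pow_left₀ h0 h1 t
    _ = avoidRatio k := by
      rw [← Real.rpow_natCast, ← Real.rpow_mul hb, avoidRatio, ← Real.rpow_natCast]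
      congr 1
      field_simp

theorem avoidRatio_pos {t : ℕ} (ht : 2 ≤ t) : 0 < avoidRatio t := by
  have ht' : (2 : ℝ) ≤ t := by exact_mod_cast ht
  refine pow_pos ?_ t
  rw [neg_div]
  have : 1 / (t : ℝ) < 1 := by rw [div_lt_one] <;> linarith
  linarith

theorem avoidRatio_le {t : ℕ} (ht : 2 ≤ t) : avoidRatio t ≤ 1 / Real.exp 1 := by
  have ht' : (1 : ℝ) ≤ t := by exact_mod_cast (by omega : 1 ≤ t)
  have := Real.one_sub_div_pow_le_exp_neg ht'
  rw [Real.exp_neg, ← one_div] at this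
  rwa [avoidRatio, neg_div, ← sub_eq_add_neg]

/-- Constants only help avoidance: (m + c') / (m + 1 + c') ≥ m / (m + 1), and r ≤ m + 1. Here `c'`
counts the values of the constants and `c` the symbols, several of which may share a value. -/
theorem pow_sub_pow_le {m c c' r : ℕ} (hc : c' ≤ c) (hr : r ≤ m + 1) :
    (((m + 1 + c') ^ r - (m + c') ^ r : ℕ) : ℝ) ≤
      ((m + 1 + c : ℕ) : ℝ) ^ r * (1 - avoidRatio (m + 1)) := by
  have hb : 1 + (-1) / ((m + 1 : ℕ) : ℝ) = m / (m + 1) := by push_cast; field_simp; ring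
  have hb0 : (0 : ℝ) ≤ m / (m + 1) := by positivity
  have hb1 : (m : ℝ) / (m + 1) ≤ 1 := by rw [div_le_one] <;> linarith [(m.cast_nonneg : (0:ℝ) ≤ m)]
  have h1 : ((m + 1 + c' : ℕ) : ℝ) * (m / (m + 1)) ≤ (m + c' : ℕ) := by
    push_cast
    have : ((m : ℝ) + 1 + c') * (m / (m + 1)) = m + c' * (m / (m + 1)) := by field_simp
    rw [this]
    nlinarith [(c'.cast_nonneg : (0:ℝ) ≤ c')]
  have h2 : ((m + 1 + c' : ℕ) : ℝ) ^ r * avoidRatio (m + 1) ≤ ((m + c' : ℕ) : ℝ) ^ r := by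
    calc _ ≤ ((m + 1 + c' : ℕ) : ℝ) ^ r * (m / (m + 1)) ^ r := by
          rw [avoidRatio, hb]
          exact mul_le_mul_of_nonneg_left (pow_le_pow_of_le_one hb0 hb1 hr) (by positivity)
      _ = (((m + 1 + c' : ℕ) : ℝ) * (m / (m + 1))) ^ r := (mul_pow _ _ _).symm
      _ ≤ _ := pow_le_pow_left₀ (by positivity) h1 r
  have h3 : avoidRatio (m + 1) ≤ 1 := by
    rw [avoidRatio, hb]; exact pow_le_one₀ hb0 hb1
  have h4 : ((m + 1 + c' : ℕ) : ℝ) ^ r ≤ ((m + 1 + c : ℕ) : ℝ) ^ r := by gcongr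
  rw [Nat.cast_sub (Nat.pow_le_pow_left (by omega) r)]
  push_cast at *
  nlinarith

/-- This is x² / 2 ≤ exp x at x = δ N log 2. -/
theorem size_estimate {δ : ℝ} (hδ : 0 < δ) (N : ℕ) :
    18 * (N : ℝ) ^ 2 ≤ 36 / (δ * Real.log 2) ^ 2 * 2 ^ (δ * N) := by
  have hl : 0 < Real.log 2 := Real.log_pos one_lt_two
  have hx : 0 ≤ δ * Real.log 2 * N := by positivity
  have h1 := Real.quadratic_le_exp_of_nonneg hx
  have h2 : (2 : ℝ) ^ (δ * N) = Real.exp (δ * Real.log 2 * N) := by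
    rw [Real.rpow_def_of_pos two_pos]
    congr 1
    ring
  rw [h2]
  calc 18 * (N : ℝ) ^ 2 = 36 / (δ * Real.log 2) ^ 2 * ((δ * Real.log 2 * N) ^ 2 / 2) := by
        field_simp; ring
    _ ≤ _ := by gcongr; linarith

/-! ### Finite models -/

/-- The finite model property of the guarded fragment, with a bound in terms of the number `N` of
atoms and the number `d` of atoms that mention a given variable. -/
theorem exists_finite_model {φ : Formula} (hφ : φ.IsGF) (hs : φ.IsSentence)
    (hsat : Satisfiable φ) (hk : 2 ≤ (nfSignature φ).width) :
    ∃ d : ℕ, (d : ℝ) ≤ Nat.card ((nfSignature φ).Atom (nfSignature φ).width) *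
        (1 - avoidRatio (nfSignature φ).width) ∧
      ∃ (B : Type) (_ : Finite B) (M : Struc B), M.Models φ ∧
        Nat.card B ≤ 18 * Nat.card ((nfSignature φ).Atom (nfSignature φ).width) ^ 2 * 2 ^ d := by
  classical
  obtain ⟨A, M, hM⟩ := hsat
  obtain ⟨m, hm⟩ : ∃ m, (nfSignature φ).width = m + 1 := ⟨_, (Nat.sub_add_cancel (by omega)).symm⟩
  have hN := (nfSignature φ).width_add_card_le_card_atom (by omega)
  set N := Nat.card ((nfSignature φ).Atom (nfSignature φ).width) with hNdef
  have hcons : Fintype.card (nfSignature φ).Cons = φ.consts.card := by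
    rw [← Nat.card_eq_fintype_card]
    exact (Nat.card_eq_fintype_card (α := φ.consts)).trans (Fintype.card_coe _)
  have hcK := M.card_constElem_le φ
  let d := Nat.card (PointedAtom (nfSignature φ).ar (M.ConstElem φ) m)
  have hd : (d : ℝ) ≤ N * (1 - avoidRatio (m + 1)) := by
    have := Fintype.ofFinite (M.ConstElem φ)
    rw [Nat.card_eq_fintype_card] at hcK
    have e : d = _ := card_pointedAtom (K := M.ConstElem φ) (nfSignature φ).ar m
    rw [e, hNdef, Signature.card_atom, hm]
    push_cast
    rw [Finset.sum_mul]
    refine Finset.sum_le_sum fun R _ => ?_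
    have := pow_sub_pow_le (m := m) (hcK.trans hcons.ge)
      (hm ▸ (nfSignature φ).ar_le_width R)
    exact_mod_cast this
  have hd' : d ≤ N := by
    have h1 := avoidRatio_pos (t := m + 1) (by omega)
    have : (d : ℝ) ≤ N := by nlinarith [(N.cast_nonneg : (0 : ℝ) ≤ N)]
    exact_mod_cast this
  have hN1 : 1 ≤ N := by omega
  refine ⟨d, hm ▸ hd, ?_⟩
  have h2d : 1 ≤ 2 ^ d := Nat.one_le_two_pow
  have hNd : N ≤ N ^ 2 * 2 ^ d := by nlinarith [Nat.zero_le (N ^ 2)]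
  -- If constants name every element, the given model is already small enough.
  by_cases hall : ∀ a : A, ∃ c ∈ φ.consts, M.constI c = a
  · let e : A ≃ M.ConstElem φ := (Equiv.subtypeUnivEquiv hall).symm
    refine ⟨A, Finite.of_equiv _ e.symm, M, hM, ?_⟩
    rw [Nat.card_congr e]
    nlinarith
  push Not at hall
  obtain ⟨a, ha⟩ := hall
  set n := m + 2 ^ d * (16 * N ^ 2) with hn
  obtain ⟨ω, hω⟩ := exists_hasExtensions (K := M.ConstElem φ) (nfSignature φ).ar m n d rfl
    (extension_estimate hd' (by omega))
  obtain ⟨h, hh⟩ := exists_isLabelling (M.nfInterp φ) (Subtype.val : M.ConstElem φ → A) ω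
  have hn0 : 0 < n := by positivity
  refine ⟨Fin n ⊕ M.ConstElem φ, inferInstance, M.labelStruc φ h ⟨0, hn0⟩, fun v => ?_, ?_⟩
  · refine (sat_iff_of_isGF hh hω (by omega) (by omega) (fun R hR => ?_) ha hφ subset_rfl subset_rfl
      subset_rfl (localIso_empty hh fun _ => a) (fun x hx => ?_)).2 (hM _)
    · exact hm ▸ (nfSignature φ).ar_le_width (.inl ⟨R, hR⟩)
    · rw [hs] at hx
      simp at hx
  · rw [Nat.card_sum, Nat.card_eq_fintype_card, Fintype.card_fin, hn]
    nlinarith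

end Guarded

/-! ### Choice of the constants and the final bound -/

theorem theorem2 :
    ∃ C ε : ℕ → ℝ,
      (∀ t, 0 < C t) ∧
      (∀ t, 0 < ε t ∧ ε t < 1 / Real.exp 1) ∧
      Filter.Tendsto ε Filter.atTop (nhds 0) ∧
      ∀ (t : ℕ) (φ : Guarded.Formula), φ.IsGF → φ.IsSentence → Guarded.Satisfiable φ →
        2 ≤ t → t ≤ (Guarded.nfSignature φ).width →
        ∃ (B : Type) (_ : Finite B) (M : Guarded.Struc B), M.Models φ ∧
          (Nat.card B : ℝ) ≤
            C t * (((Guarded.nfSignature φ).types (Guarded.nfSignature φ).width).ncard : ℝ) ^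
              (1 - 1 / Real.exp 1 + ε t) := by
  classical
  -- The slack that absorbs N² must tend to 0 and stay below `avoidRatio t`, which makes ε_t < 1/e.
  let δ : ℕ → ℝ := fun t => Guarded.avoidRatio t * (1 / ((t : ℝ) + 1))
  have hlog : 0 < Real.log 2 := Real.log_pos one_lt_two
  have hδ : ∀ t, 2 ≤ t → 0 < δ t := fun t ht =>
    mul_pos (Guarded.avoidRatio_pos ht) (by positivity)
  have he : 0 < 1 / Real.exp 1 := by positivity
  refine ⟨fun t => if 2 ≤ t then 36 / (δ t * Real.log 2) ^ 2 else 1,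
    -- The exponent becomes 1 - `avoidRatio t` + δ_t. For t < 2 nothing is claimed about models, and
    -- any value in (0, 1/e) will do.
    fun t => if 2 ≤ t then 1 / Real.exp 1 - Guarded.avoidRatio t + δ t else 1 / Real.exp 1 / 2,
    fun t => ?_, fun t => ?_, ?_, ?_⟩
  · dsimp only
    split_ifs with ht
    · have := hδ t ht
      positivity
    · exact one_pos
  · dsimp only
    split_ifs with ht
    · have h1 := hδ t ht
      have h2 := Guarded.avoidRatio_le ht
      have h3 : δ t < Guarded.avoidRatio t := by
        have : (2 : ℝ) ≤ t := by exact_mod_cast ht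
        exact mul_lt_of_lt_one_right (Guarded.avoidRatio_pos ht)
          (by rw [div_lt_one] <;> linarith)
      constructor <;> linarith
    · constructor <;> linarith
  · have h1 : Filter.Tendsto Guarded.avoidRatio Filter.atTop (nhds (1 / Real.exp 1)) := by
      have := Real.tendsto_one_add_div_pow_exp (-1)
      rwa [Real.exp_neg, ← one_div] at this
    have h2 : Filter.Tendsto δ Filter.atTop (nhds (1 / Real.exp 1 * 0)) :=
      h1.mul tendsto_one_div_add_atTop_nhds_zero_nat
    have h3 := (h1.const_sub (1 / Real.exp 1)).add h2
    rw [sub_self, mul_zero, add_zero] at h3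
    refine h3.congr' ?_
    filter_upwards [Filter.eventually_ge_atTop 2] with t ht
    rw [if_pos ht]
  · intro t φ hφ hs hsat ht htk
    obtain ⟨d, hd, B, hB, M, hM, hcard⟩ :=
      Guarded.exists_finite_model hφ hs hsat (ht.trans htk)
    refine ⟨B, hB, M, hM, ?_⟩
    have htypes := (Guarded.nfSignature φ).two_pow_le_ncard_types (Guarded.nfSignature φ).width
    set N := Nat.card ((Guarded.nfSignature φ).Atom (Guarded.nfSignature φ).width)
    simp only [if_pos ht]
    have hexp : 1 - 1 / Real.exp 1 + (1 / Real.exp 1 - Guarded.avoidRatio t + δ t) =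
        1 - Guarded.avoidRatio t + δ t := by ring
    rw [hexp]
    have hδt := hδ t ht
    have he1 : 1 / Real.exp 1 ≤ 1 := by
      rw [div_le_one (Real.exp_pos 1)]
      linarith [Real.add_one_le_exp (1 : ℝ)]
    have hr := Guarded.avoidRatio_le ht
    have hmono := Guarded.avoidRatio_mono ht htk
    have hN0 : (0 : ℝ) ≤ N := N.cast_nonneg
    calc (Nat.card B : ℝ) ≤ 18 * (N : ℝ) ^ 2 * (2 : ℝ) ^ (d : ℝ) := by
          rw [Real.rpow_natCast]
          exact_mod_cast hcard
      _ ≤ 36 / (δ t * Real.log 2) ^ 2 * 2 ^ (δ t * N) *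
            (2 : ℝ) ^ (N * (1 - Guarded.avoidRatio t)) := by
          refine mul_le_mul (Guarded.size_estimate hδt N)
            (Real.rpow_le_rpow_of_exponent_le one_le_two (hd.trans ?_)) (by positivity)
            (by positivity)
          exact mul_le_mul_of_nonneg_left (by linarith) hN0
      _ = 36 / (δ t * Real.log 2) ^ 2 *
            ((2 : ℝ) ^ N) ^ (1 - Guarded.avoidRatio t + δ t) := by
          rw [mul_assoc, ← Real.rpow_add two_pos, ← Real.rpow_natCast 2 N,
            ← Real.rpow_mul zero_le_two]
          congr 2
          ring
      _ ≤ _ := by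
          refine mul_le_mul_of_nonneg_left (Real.rpow_le_rpow (by positivity) ?_ (by linarith))
            (by positivity)
          exact_mod_cast htypes
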